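/- **Setting.** Let $\{X_t\}_{t\ge 0}$ and $\{W_t\}_{t\ge 0}$ be independent Markov chains on measurable spaces $E_1,E_2$ with transition probabilities $P_1,P_2$. Assume that $\{X_t\}$ is $\phi_1$-irreducible and Harris recurrent, and that $\{W_t\}$ is $\phi_2$-irreducible and ergodic (there is an invariant probability measure $\pi_2$, and $P_2^n(w,\cdot)\to\pi_2$ in total variation for every $w$). Assume that for $j=1,2$ there are a measurable function $s_j\ge 0$ on $E_j$ with $\phi_j(s_j>0)>0$ and a probability measure $\nu_j$ on $E_j$ with $P_j(x,A)\ge s_j(x)\nu_j(A)$ for all $x$ and all measurable $A$. The split chain $\{(X_t,Y^1_t)\}$, $Y^1_t\in\{0,1\}$, is the Markov chain in which, given the past and $X_t$, $Y^1_t=1$ with probability $s_1(X_t)$, and $X_{t+1}$ has law $\nu_1$ if $Y^1_t=1$ and law $Q_1(X_t,\cdot)$ if $Y^1_t=0$; here $Q_1(x,\cdot)=(P_1(x,\cdot)-s_1(x)\nu_1)/(1-s_1(x))$ if $s_1(x)<1$ and $Q_1(x,\cdot)=\delta_x$ if $s_1(x)=1$. The split chain $\{(W_t,Y^2_t)\}$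 is defined in the same way from $P_2,s_2,\nu_2$, and the two split chains are independent. Put $Y_t=Y_t^1Y_t^2$. With $\tau^1_{-1}=\tau_{-1}=-1$ and $\inf\emptyset=\infty$ let, for $k\ge 0$, $$\tau^1_k=\inf\{t>\tau^1_{k-1}: Y^1_t=1\},\qquad \tau_k=\inf\{t>\tau_{k-1}: Y_t=1\},\qquad \mathcal T=\inf\{j\ge 0: Y^2_{\tau^1_j}=1\}.$$ Let $\mathbb E_\nu$ be the expectation when $(X_0,W_0)$ has law $\nu=\nu_1\otimes\nu_2$, and let $\pi_{s_2}=\sum_{\ell\ge 0}\nu_2(P_2-s_2\otimes\nu_2)^\ell$. Let $g_X:E_1\to\mathbb R$ and $g_W:E_2\to\mathbb R$ be measurable, $g(x,w)=g_X(x)g_W(w)$, and $$V_j=\sum_{t=\tau^1_{j-1}+1}^{\tau^1_j} g(X_t,W_t),\qquad j\ge 0 .$$ Let $U(g)$ be a random variable with the common distribution of the blocks $\sum_{t=\tau_{k-1}+1}^{\tau_k} g(X_t,W_t)$, $k\ge 1$, of the compound chain, and let $U(|g_X|)$ be a random variable with the common distribution of the blocks $\sum_{t=\tau^1_{k-1}+1}^{\tau^1_k}|g_X|(X_t)$,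 $k\ge 1$, of the chain $\{X_t\}$; these distributions depend neither on $k\ge 1$ nor on the initial distribution of the chains. **Theorem 3.2.** For every real $m\ge 1$, $$\mathbb E_\nu \sum_{j=0}^{\mathcal T}|V_j|^m\;\le\;\Big(\int |g_W|^m\,d\pi_{s_2}\Big)\;\mathbb E\,U^m(|g_X|).$$ For all real $p>0$ and $\delta\in(0,\infty)$, $$\mathbb E|U(g)|^p\;\le\;\Big(\mathbb E_\nu \sum_{j=0}^{\mathcal T}|V_j|^{p(1+\delta)}\Big)^{1/(1+\delta)}\Big(\mathbb E_\nu(\mathcal T+1)^{p(1+\delta^{-1})}\Big)^{\delta/(1+\delta)} .$$ All expectations take values in $[0,\infty]$, with $0\cdot\infty=0$. -/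

import Mathlib

open MeasureTheory ProbabilityTheory Filter
open scoped ENNReal Topology

noncomputable section

namespace SplitChain

/-! ### Markov chains on a general state space -/

section Chain

variable {S : Type*} [MeasurableSpace S]

/-- The law `ℙ_λ` on path space `ℕ → S` of the time-homogeneous Markov chain with initial law `lam`
and transition probability `K`. -/
def pathMeasure (K : Kernel S S) [IsMarkovKernel K] (lam : Measure S) : Measure (ℕ → S) :=
  Kernel.trajMeasure (X := fun _ => S) lam
    (fun n => K.comap (fun h => h ⟨n, Finset.mem_Iic.2 le_rfl⟩) (measurable_pi_apply _))

/-- A `φ`-irreducible Harris recurrent transition probability: from every starting point, every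
`φ`-positive set is visited infinitely often with probability one. -/
structure IsHarrisRecurrent (P : Kernel S S) [IsMarkovKernel P] (φ : Measure S) : Prop where
  nontrivial : φ ≠ 0
  irreducible : Kernel.IsIrreducible φ P
  recurrent : ∀ x : S, ∀ A : Set S, MeasurableSet A → 0 < φ A →
    ∀ᵐ ω ∂ pathMeasure P (Measure.dirac x), ∃ᶠ n in atTop, ω n ∈ A

/-- A `φ`-irreducible ergodic transition probability: there is an invariant probability measure `π`
and, for every starting point `x`, `P^n(x, ·)` converges to `π` in total variation. -/
structure IsErgodic (P : Kernel S S) [IsMarkovKernel P] (φ : Measure S) : Prop where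
  nontrivial : φ ≠ 0
  irreducible : Kernel.IsIrreducible φ P
  ergodic : ∃ π : Measure S, IsProbabilityMeasure π ∧ Kernel.Invariant P π ∧
    ∀ x : S, TendstoUniformlyOn (fun n A => ((P ^ n) x).real A) (fun A => π.real A) atTop
      {A | MeasurableSet A}

/-- An atom `(s, ν)` for `P`: a nonnegative measurable function `s` with `φ`-positive support and a
probability measure `ν` satisfying the minorization inequality `P ≥ s ⊗ ν`. -/
structure Atom (P : Kernel S S) (φ : Measure S) where
  s : S → ℝ≥0∞
  ν : Measure S
  measurable_s : Measurable s
  support_pos : 0 < φ {x | s x ≠ 0}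
  isProb : IsProbabilityMeasure ν
  minorization : ∀ x : S, ∀ A : Set S, MeasurableSet A → s x * ν A ≤ P x A

namespace Atom

variable {P : Kernel S S} {φ : Measure S} (a : Atom P φ)

instance : IsProbabilityMeasure a.ν := a.isProb

lemma s_le_one [IsMarkovKernel P] (x : S) : a.s x ≤ 1 := by
  simpa using a.minorization x Set.univ MeasurableSet.univ

lemma smul_le (x : S) : a.s x • a.ν ≤ P x :=
  Measure.le_iff.2 fun A hA => by simpa using a.minorization x A hA

variable [IsMarkovKernel P]

lemma isFinite_smul (x : S) : IsFiniteMeasure (a.s x • a.ν) :=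
  Measure.smul_finite _ (ne_top_of_le_ne_top ENNReal.one_ne_top (a.s_le_one x))

lemma sub_apply (x : S) {A : Set S} (hA : MeasurableSet A) :
    (P x - a.s x • a.ν) A = P x A - a.s x * a.ν A := by
  have := a.isFinite_smul x
  rw [Measure.sub_apply hA (a.smul_le x)]
  simp

/-- The taboo kernel `H = P - s ⊗ ν`. -/
def H : Kernel S S where
  toFun x := P x - a.s x • a.ν
  measurable' := by
    refine Measure.measurable_of_measurable_coe _ fun A hA => ?_
    simp_rw [a.sub_apply _ hA]
    exact (P.measurable_coe hA).sub (a.measurable_s.mul_const _)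

/-- The kernel `G = ∑_{ℓ ≥ 0} H^ℓ`. -/
def G : Kernel S S := Kernel.sum fun l : ℕ => a.H ^ l

/-- The measure `π_s = ν G`. -/
def piS : Measure S := a.ν.bind a.G

/-- The residual transition probability `Q`: `Q(x, ·) = (P(x, ·) - s(x) ν) / (1 - s(x))` when
`s(x) < 1`, and the point mass at `x` when `s(x) = 1`; thus `P = (1 - s) Q + s ⊗ ν`. -/
def Q : Kernel S S where
  toFun x := if a.s x < 1 then (1 - a.s x)⁻¹ • a.H x else Measure.dirac x
  measurable' := by
    refine Measurable.ite (measurableSet_lt a.measurable_s measurable_const) ?_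
      Measure.measurable_dirac
    refine Measure.measurable_of_measurable_coe _ fun A hA => ?_
    simp only [Measure.smul_apply, smul_eq_mul]
    exact ((measurable_const.sub a.measurable_s).inv).mul (a.H.measurable_coe hA)

instance : IsMarkovKernel a.Q where
  isProbabilityMeasure x := by
    constructor
    change (if a.s x < 1 then (1 - a.s x)⁻¹ • a.H x else Measure.dirac x) Set.univ = 1
    split_ifs with h
    · have h1 : a.H x Set.univ = 1 - a.s x := by
        change (P x - a.s x • a.ν) Set.univ = _
        rw [a.sub_apply x MeasurableSet.univ]
        simp
      rw [Measure.smul_apply, h1, smul_eq_mul]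
      exact ENNReal.inv_mul_cancel (tsub_pos_of_lt h).ne'
        (ne_top_of_le_ne_top ENNReal.one_ne_top tsub_le_self)
    · simp

/-- Given `X_t = x`, the mark `Y_t` equals `1` (coded as `true`) with probability `s(x)` and `0`
(coded as `false`) with probability `1 - s(x)`. -/
def mark : Kernel S Bool where
  toFun x := a.s x • Measure.dirac true + (1 - a.s x) • Measure.dirac false
  measurable' := by
    refine Measure.measurable_of_measurable_coe _ fun A hA => ?_
    simp only [Measure.add_apply, Measure.smul_apply, smul_eq_mul]
    exact (a.measurable_s.mul_const _).add ((measurable_const.sub a.measurable_s).mul_const _)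

instance : IsMarkovKernel a.mark where
  isProbabilityMeasure x := by
    constructor
    change (a.s x • Measure.dirac true + (1 - a.s x) • Measure.dirac false) (Set.univ : Set Bool) = 1
    simp [add_tsub_cancel_of_le (a.s_le_one x)]

/-- The kernel `x ↦ δ_x ⊗ mark x`, which adjoins the mark to a state. -/
def adjoin : Kernel S (S × Bool) := Kernel.id ×ₖ a.mark

instance : IsMarkovKernel a.adjoin := by unfold adjoin; infer_instance

/-- The law of the next state of the split chain given the current pair (state, mark): it is `ν` when
the mark is `1` and `Q(x, ·)` when the mark is `0`. -/
def next : Kernel (S × Bool) S where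
  toFun z := if z.2 = true then a.ν else a.Q z.1
  measurable' := Measurable.ite (measurable_snd (MeasurableSet.singleton true)) measurable_const
    (a.Q.measurable.comp measurable_fst)

instance : IsMarkovKernel a.next where
  isProbabilityMeasure z := by
    change IsProbabilityMeasure (if z.2 = true then a.ν else a.Q z.1)
    split_ifs <;> infer_instance

/-- The transition probability of the split chain `(X_t, Y_t)`: draw the next state, then its mark. -/
def split : Kernel (S × Bool) (S × Bool) := a.adjoin ∘ₖ a.next

instance : IsMarkovKernel a.split := by unfold split; infer_instance

/-- The law `ℙ_λ` of the split chain `(X_t, Y_t)_{t ≥ 0}` when `X_0` has law `lam`. -/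
def splitLaw (lam : Measure S) : Measure (ℕ → S × Bool) :=
  pathMeasure a.split (lam.bind a.adjoin)

end Atom

end Chain

/-! ### Regeneration times and blocks

The sequence `y : ℕ → Bool` is a realization of the marks; infima over the empty set are `⊤ = ∞`. -/

/-- The regeneration times `τ_0 = inf {t ≥ 0 : y_t = 1}`, `τ_{k+1} = inf {t > τ_k : y_t = 1}`. -/
def regTime (y : ℕ → Bool) : ℕ → ℕ∞
  | 0 => ⨅ (t : ℕ) (_ : y t = true), (t : ℕ∞)
  | k + 1 => ⨅ (t : ℕ) (_ : regTime y k < t) (_ : y t = true), (t : ℕ∞)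

/-- The `k`-th block `{t : τ_{k-1} < t ≤ τ_k}` of time points, where `τ_{-1} = -1`. -/
def block (y : ℕ → Bool) : ℕ → Set ℕ
  | 0 => {t | (t : ℕ∞) ≤ regTime y 0}
  | k + 1 => {t | regTime y k < t ∧ (t : ℕ∞) ≤ regTime y (k + 1)}

/-- The block sum `∑_{t = τ_{k-1}+1}^{τ_k} h(t)`; the sum is finite whenever `τ_k < ∞`. -/
def blockSum (y : ℕ → Bool) (h : ℕ → ℝ) (k : ℕ) : ℝ := ∑' t : block y k, h t

section Pair

variable {E₁ E₂ : Type*}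

/-- `U_k(f)` for a single split chain with path `x`: the sum of `f(X_t)` over its `k`-th block. -/
def U₁ (f : E₁ → ℝ) (k : ℕ) (x : ℕ → E₁ × Bool) : ℝ :=
  blockSum (fun t => (x t).2) (fun t => f (x t).1) k

/-- `U_k(g)` for the compound chain, whose mark is `Y_t = Y_t¹ Y_t²`. -/
def U (g : E₁ → E₂ → ℝ) (k : ℕ) (ω : (ℕ → E₁ × Bool) × (ℕ → E₂ × Bool)) : ℝ :=
  blockSum (fun t => (ω.1 t).2 && (ω.2 t).2) (fun t => g (ω.1 t).1 (ω.2 t).1) k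

/-- The sub-block `V_j(g)`: the sum of `g(X_t, W_t)` over the `j`-th block of the marginal
regenerations of `X`. -/
def V (g : E₁ → E₂ → ℝ) (j : ℕ) (ω : (ℕ → E₁ × Bool) × (ℕ → E₂ × Bool)) : ℝ :=
  blockSum (fun t => (ω.1 t).2) (fun t => g (ω.1 t).1 (ω.2 t).1) j

/-- `𝒯 = inf {j ≥ 0 : Y²_{τ_j¹} = 1}`, where `τ_j¹` are the regeneration times of `X`. -/
def T (ω : (ℕ → E₁ × Bool) × (ℕ → E₂ × Bool)) : ℕ∞ :=
  ⨅ (j : ℕ) (_ : ∃ t : ℕ, regTime (fun i => (ω.1 i).2) j = t ∧ (ω.2 t).2 = true), (j : ℕ∞)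

open Classical in
/-- The random variable `∑_{j=0}^{𝒯} |V_j(g)|^r` with values in `[0, ∞]`. -/
def sumV (g : E₁ → E₂ → ℝ) (r : ℝ) (ω : (ℕ → E₁ × Bool) × (ℕ → E₂ × Bool)) : ℝ≥0∞ :=
  ∑' j : ℕ, if (j : ℕ∞) ≤ T ω then ‖V g j ω‖ₑ ^ r else 0

end Pair

section Law

variable {E₁ E₂ : Type*} [MeasurableSpace E₁] [MeasurableSpace E₂]
  {P₁ : Kernel E₁ E₁} [IsMarkovKernel P₁] {φ₁ : Measure E₁}
  {P₂ : Kernel E₂ E₂} [IsMarkovKernel P₂] {φ₂ : Measure E₂}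

/-- The law `ℙ_λ`, `λ = λ₁ ⊗ λ₂`, of the pair of split chains `(X_t, Y_t¹)` and `(W_t, Y_t²)`, which
are independent. -/
def jointLaw (a₁ : Atom P₁ φ₁) (a₂ : Atom P₂ φ₂) (lam₁ : Measure E₁) (lam₂ : Measure E₂) :
    Measure ((ℕ → E₁ × Bool) × (ℕ → E₂ × Bool)) :=
  (a₁.splitLaw lam₁).prod (a₂.splitLaw lam₂)

end Law

end SplitChain

end

open MeasureTheory ProbabilityTheory Filter
open scoped ENNReal Topology

noncomputable section

/-! First bound. Write H = P₂ - s₂ ⊗ ν₂, and let B be the sum of |g_X| over the first X-block.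
Jensen's inequality with weights |g_X(X_t)| bounds |V_0|^m by the sum of |g_X(X_t)| B^(m-1)
|g_W(W_t)|^m over that block (`enorm_V_zero_rpow_le`). By independence, the mean given W_0 = w is at
most v(w) = ∑ c_t (P₂^t |g_W|^m)(w), where ∑ c_t = E U^m(|g_X|), because X regenerates almost surely
(`Atom.measure_hit_eq_top_eq_zero`).

If X first regenerates at time u, which has probability b_u, the sum goes on only when Y²_u = 0, and
W then continues from P₂^u H. Hence the expected sums f_N over the first N sub-blocks satisfy
f_{N+1} ≤ v + K f_N with K = ∑ b_u P₂^u H. The measure π = π_{s₂} satisfies π = ν₂ + πH and π(s₂) ≤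
1, so πP₂ = π(s₂)ν₂ + πH ≤ π and ν₂ + πK ≤ ν₂ + πH = π (`Atom.add_bind_sampledH_le`). Iteration
gives ∫ f_N dν₂ ≤ ∫ v dπ (`lintegral_iterate_le`), and πP₂^t ≤ π bounds this by (∑ c_t) ∫ |g_W|^m
dπ.

Second bound. The first compound block is the disjoint union of the sub-blocks 0, …, 𝒯, and each
|V_j| is at most (∑ |V_i|^r)^(1/r). So |U_0| is at most this quantity times 𝒯 + 1, and Hölder's
inequality with r = p(1+δ) concludes. Later compound blocks reduce to the first by regeneration. -/

namespace SplitChain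

/-! ### Markov laws on path space and the first-step decomposition -/

section PathSpace

variable {S : Type*}

/-- The path `ω` frozen at time `n`. -/
def stopAt (n : ℕ) (ω : ℕ → S) : ℕ → S := fun i => ω (min i n)

/-- The shift by `n` on path space. -/
def shift (n : ℕ) (ω : ℕ → S) : ℕ → S := fun i => ω (i + n)

/-- The path which starts at `x` and then follows `ω`. -/
def prepend (x : S) (ω : ℕ → S) : ℕ → S
  | 0 => x
  | n + 1 => ω n

@[simp] lemma prepend_zero (x : S) (ω : ℕ → S) : prepend x ω 0 = x := rfl

@[simp] lemma prepend_succ (x : S) (ω : ℕ → S) (n : ℕ) : prepend x ω (n + 1) = ω n := rfl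

lemma stopAt_apply_of_le {i n : ℕ} (h : i ≤ n) (ω : ℕ → S) : stopAt n ω i = ω i := by
  simp [stopAt, h]

lemma stopAt_zero_prepend (x : S) (ω : ℕ → S) : stopAt 0 (prepend x ω) = fun _ => x := by
  funext i
  simp [stopAt]

lemma stopAt_succ_prepend (n : ℕ) (x : S) (ω : ℕ → S) :
    stopAt (n + 1) (prepend x ω) = prepend x (stopAt n ω) := by
  funext i
  cases i with
  | zero => simp [stopAt]
  | succ i => simp [stopAt, Nat.add_min_add_right]

lemma shift_succ_prepend (n : ℕ) (x : S) (ω : ℕ → S) :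
    shift (n + 1) (prepend x ω) = shift n ω := rfl

lemma shift_one_prepend (x : S) (ω : ℕ → S) : shift 1 (prepend x ω) = ω := rfl

variable [MeasurableSpace S]

@[fun_prop]
lemma measurable_stopAt (n : ℕ) : Measurable (stopAt n : (ℕ → S) → ℕ → S) :=
  measurable_pi_lambda _ fun _ => measurable_pi_apply _

@[fun_prop]
lemma measurable_shift (n : ℕ) : Measurable (shift n : (ℕ → S) → ℕ → S) :=
  measurable_pi_lambda _ fun _ => measurable_pi_apply _

lemma measurable_prepend : Measurable fun p : S × (ℕ → S) => prepend p.1 p.2 := by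
  refine measurable_pi_lambda _ fun n => ?_
  cases n with
  | zero => exact measurable_fst
  | succ n => exact (measurable_pi_apply n).comp measurable_snd

@[fun_prop]
lemma measurable_prepend_right (x : S) : Measurable (prepend x) :=
  measurable_prepend.comp (measurable_const.prodMk measurable_id)

/-- The one-step Markov property for a measure on path space. -/
def IsMarkovLaw (K : Kernel S S) (μ : Measure (ℕ → S)) : Prop :=
  ∀ n : ℕ, ∀ F : (ℕ → S) × S → ℝ≥0∞, Measurable F →
    ∫⁻ ω, F (stopAt n ω, ω (n + 1)) ∂μ = ∫⁻ ω, ∫⁻ z, F (stopAt n ω, z) ∂K (ω n) ∂μ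

/-- Two measures on path space are equal if they agree on the paths frozen at each time. -/
lemma measure_eq_of_map_stopAt {μ ν : Measure (ℕ → S)} [IsFiniteMeasure μ]
    (h : ∀ n, μ.map (stopAt n) = ν.map (stopAt n)) : μ = ν := by
  have key : ∀ I : Finset ℕ, ν.map I.restrict = μ.map I.restrict := by
    intro I
    -- All times in `I` are at most `I.sup id`, so each finite-dimensional marginal factors through
    -- a frozen path.
    have hI : (I.restrict : (ℕ → S) → (i : I) → S) = I.restrict ∘ stopAt (I.sup id) := by
      funext ω i
      exact (stopAt_apply_of_le (Finset.le_sup (f := id) i.2) ω).symm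
    rw [hI, ← Measure.map_map (by fun_prop) (by fun_prop), ← h,
      Measure.map_map (by fun_prop) (by fun_prop)]
  refine IsProjectiveLimit.unique (P := fun I : Finset ℕ => μ.map I.restrict)
    (fun I => rfl) (fun I => key I)

/-- By induction on the freezing time, the initial law and the one-step transitions fix the law of
every frozen path. -/
lemma IsMarkovLaw.unique {K : Kernel S S} [IsMarkovKernel K] {μ ν : Measure (ℕ → S)}
    [IsFiniteMeasure μ] (hμ : IsMarkovLaw K μ) (hν : IsMarkovLaw K ν)
    (h0 : μ.map (fun ω => ω 0) = ν.map (fun ω => ω 0)) : μ = ν := by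
  refine measure_eq_of_map_stopAt fun n => ?_
  induction n with
  | zero =>
    have hs : (stopAt 0 : (ℕ → S) → ℕ → S) = (fun x _ => x) ∘ fun ω => ω 0 := by
      funext ω i
      simp [stopAt]
    rw [hs, ← Measure.map_map (by fun_prop) (by fun_prop), h0,
      Measure.map_map (by fun_prop) (by fun_prop)]
  | succ n ih =>
    -- `g` rebuilds the path frozen at `n + 1` from the path frozen at `n` and one new value.
    let g : (ℕ → S) × S → ℕ → S := fun p i => if i ≤ n then p.1 i else p.2
    have hg : Measurable g := by
      refine measurable_pi_lambda _ fun i => ?_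
      by_cases hi : i ≤ n
      · simpa [g, hi] using (measurable_pi_apply (X := fun _ : ℕ => S) i).fun_comp measurable_fst
      · simpa [g, hi] using measurable_snd
    have hs (ω : ℕ → S) : stopAt (n + 1) ω = g (stopAt n ω, ω (n + 1)) := by
      funext i
      by_cases hi : i ≤ n
      · simp [g, stopAt, hi, hi.trans (Nat.le_succ n)]
      · have : n + 1 ≤ i := by omega
        simp [g, stopAt, hi, this]
    have step {ρ : Measure (ℕ → S)} (hρ : IsMarkovLaw K ρ) {f : (ℕ → S) → ℝ≥0∞}
        (hf : Measurable f) :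
        ∫⁻ ω, f ω ∂ρ.map (stopAt (n + 1)) =
          ∫⁻ ω, ∫⁻ z, f (g (ω, z)) ∂K (ω n) ∂ρ.map (stopAt n) := by
      rw [lintegral_map hf (by fun_prop), lintegral_map _ (by fun_prop)]
      · simp_rw [hs]
        rw [hρ n (fun p => f (g p)) (hf.comp hg)]
        simp [stopAt]
      · exact Measurable.lintegral_kernel_prod_right'
          (κ := K.comap (fun ω : ℕ → S => ω n) (measurable_pi_apply n)) (hf.comp hg)
    refine Measure.ext_of_lintegral _ fun f hf => ?_
    rw [step hμ hf, step hν hf, ih]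

variable (K : Kernel S S) [IsMarkovKernel K]

/-- The law on path space of the Markov chain with transition probability `K`, as a kernel in the
starting point. -/
def pathK : Kernel S (ℕ → S) :=
  (Kernel.traj (X := fun _ => S)
    (fun n => K.comap (fun h => h ⟨n, Finset.mem_Iic.2 le_rfl⟩) (measurable_pi_apply _)) 0).comap
    (MeasurableEquiv.piUnique (fun _ : Finset.Iic 0 => S)).symm (MeasurableEquiv.measurable _)

instance : IsMarkovKernel (pathK K) := by unfold pathK; infer_instance

lemma pathMeasure_eq (lam : Measure S) : pathMeasure K lam = lam.bind (pathK K) := by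
  refine Measure.ext_of_lintegral _ fun f hf => ?_
  rw [Measure.lintegral_bind (pathK K).aemeasurable hf.aemeasurable, pathMeasure,
    Kernel.trajMeasure, Measure.lintegral_bind (Kernel.aemeasurable _) hf.aemeasurable,
    lintegral_map hf.lintegral_kernel (MeasurableEquiv.measurable _)]
  rfl

lemma pathMeasure_dirac (x : S) : pathMeasure K (Measure.dirac x) = pathK K x := by
  rw [pathMeasure_eq, Measure.dirac_bind (pathK K).measurable]

lemma isMarkovLaw_pathK (x : S) : IsMarkovLaw K (pathK K x) := by
  intro n F hF
  have h := Kernel.map_frestrictLe_trajMeasure_compProd_eq_map_trajMeasure (X := fun _ => S)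
    (κ := fun n => K.comap (fun h => h ⟨n, Finset.mem_Iic.2 le_rfl⟩) (measurable_pi_apply _))
    (μ₀ := Measure.dirac x) (a := n)
  rw [← pathMeasure_dirac]
  -- `e` turns a history up to `n` into a path frozen at `n`, so that histories match `stopAt n`.
  let e : (Finset.Iic n → S) → ℕ → S := fun h i => h ⟨min i n, Finset.mem_Iic.2 (min_le_right i n)⟩
  have he : Measurable e := measurable_pi_lambda _ fun i => measurable_pi_apply _
  have hG : Measurable fun p : (Finset.Iic n → S) × S => F (e p.1, p.2) := by fun_prop
  have h2 := congrArg (fun m => ∫⁻ p, F (e p.1, p.2) ∂m) h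
  have hK := Measurable.lintegral_kernel_prod_right'
    (κ := K.comap (fun h : Finset.Iic n → S => h ⟨n, Finset.mem_Iic.2 le_rfl⟩)
      (measurable_pi_apply _)) hG
  rw [Measure.lintegral_compProd hG, lintegral_map hG (by fun_prop),
    lintegral_map hK (by fun_prop)] at h2
  exact h2.symm

lemma pathK_map_zero (x : S) : (pathK K x).map (fun ω => ω 0) = Measure.dirac x := by
  have h := Kernel.traj_map_frestrictLe_apply (X := fun _ => S)
    (κ := fun n => K.comap (fun h => h ⟨n, Finset.mem_Iic.2 le_rfl⟩) (measurable_pi_apply _))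
    0 0 ((MeasurableEquiv.piUnique (fun _ : Finset.Iic 0 => S)).symm x)
  rw [Kernel.partialTraj_self, Kernel.id_apply] at h
  have h2 := congrArg (Measure.map fun z : Finset.Iic 0 → S => z ⟨0, by simp⟩) h
  rw [Measure.map_map (by fun_prop) (by fun_prop)] at h2
  exact h2.trans (Measure.map_dirac' (by fun_prop) _)

/-- Decomposition of the law of a Markov chain at its first step. -/
theorem lintegral_pathK (x : S) {F : (ℕ → S) → ℝ≥0∞} (hF : Measurable F) :
    ∫⁻ ω, F ω ∂pathK K x = ∫⁻ y, ∫⁻ ω, F (prepend x ω) ∂pathK K y ∂K x := by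
  have hb : ∀ G : (ℕ → S) → ℝ≥0∞, Measurable G →
      ∫⁻ ω, G ω ∂(((K x).bind (pathK K)).map (prepend x)) =
        ∫⁻ y, ∫⁻ ω, G (prepend x ω) ∂pathK K y ∂K x := fun G hG => by
    rw [lintegral_map hG (by fun_prop), Measure.lintegral_bind (pathK K).aemeasurable
      (hG.fun_comp (measurable_prepend_right x)).aemeasurable]
  -- Taking one step and then prepending `x` is again Markov for `K` and starts at `x`; uniqueness
  -- identifies the two laws.
  suffices h : pathK K x = ((K x).bind (pathK K)).map (prepend x) by rw [h, hb F hF]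
  have h00 (y : S) {f : S → ℝ≥0∞} (hf : Measurable f) : ∫⁻ ω, f (ω 0) ∂pathK K y = f y := by
    rw [← lintegral_map (μ := pathK K y) hf (measurable_pi_apply 0), pathK_map_zero,
      lintegral_dirac' _ hf]
  refine (isMarkovLaw_pathK K x).unique ?_ ?_
  · intro n F hF
    have hK : Measurable fun ω : ℕ → S => ∫⁻ z, F (stopAt n ω, z) ∂K (ω n) :=
      Measurable.lintegral_kernel_prod_right'
        (κ := K.comap (fun ω : ℕ → S => ω n) (measurable_pi_apply n))
        (f := fun p => F (stopAt n p.1, p.2)) (by fun_prop)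
    rw [hb (fun ω => F (stopAt n ω, ω (n + 1))) (by fun_prop), hb _ hK]
    cases n with
    | zero =>
      have hF' : Measurable fun z => F (fun _ => x, z) := by fun_prop
      simp only [stopAt_zero_prepend, prepend_succ, zero_add, prepend_zero, lintegral_const,
        measure_univ, mul_one]
      exact lintegral_congr fun y => h00 y hF'
    | succ n =>
      refine lintegral_congr fun y => ?_
      simp only [stopAt_succ_prepend, prepend_succ]
      exact isMarkovLaw_pathK K y n (fun p => F (prepend x p.1, p.2))
        (hF.comp (((measurable_prepend_right x).comp measurable_fst).prodMk measurable_snd))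
  · rw [pathK_map_zero, Measure.map_map (by fun_prop) (by fun_prop)]
    have : ((fun ω : ℕ → S => ω 0) ∘ prepend x) = fun _ => x := rfl
    rw [this, Measure.map_const, Measure.bind_apply MeasurableSet.univ (pathK K).aemeasurable]
    simp

end PathSpace

end SplitChain

namespace SplitChain

/-! ### The split chain: first step and regeneration at a fixed time -/

namespace Atom

variable {S : Type*} [MeasurableSpace S] {P : Kernel S S} {φ : Measure S} (a : Atom P φ)
  [IsMarkovKernel P]

lemma lintegral_P (x : S) (f : S → ℝ≥0∞) :
    ∫⁻ y, f y ∂P x = a.s x * ∫⁻ y, f y ∂a.ν + ∫⁻ y, f y ∂a.H x := by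
  have := a.isFinite_smul x
  have h : P x = a.s x • a.ν + a.H x := by
    change P x = a.s x • a.ν + (P x - a.s x • a.ν)
    rw [add_comm, Measure.sub_add_cancel_of_le (a.smul_le x)]
  conv_lhs => rw [h]
  rw [lintegral_add_measure, lintegral_smul_measure, smul_eq_mul]

lemma H_le (x : S) : a.H x ≤ P x := Measure.sub_le

instance : IsFiniteKernel a.H :=
  ⟨1, ENNReal.one_lt_top, fun x => (a.H_le x Set.univ).trans (by simp)⟩

lemma H_univ (x : S) : a.H x Set.univ = 1 - a.s x := by
  change (P x - a.s x • a.ν) Set.univ = _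
  rw [a.sub_apply x MeasurableSet.univ]
  simp

/-- If `s x = 1` both sides vanish, since `H x` has mass `1 - s x`; the conventional value of `Q x`
there plays no role. -/
lemma one_sub_mul_lintegral_Q (x : S) (f : S → ℝ≥0∞) :
    (1 - a.s x) * ∫⁻ y, f y ∂a.Q x = ∫⁻ y, f y ∂a.H x := by
  by_cases h : a.s x < 1
  · have hQ : a.Q x = (1 - a.s x)⁻¹ • a.H x := if_pos h
    rw [hQ, lintegral_smul_measure, smul_eq_mul, ← mul_assoc, ENNReal.mul_inv_cancel
      (tsub_pos_of_lt h).ne' (ne_top_of_le_ne_top ENNReal.one_ne_top tsub_le_self), one_mul]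
  · have h1 : a.s x = 1 := le_antisymm (a.s_le_one x) (not_lt.1 h)
    have hH : a.H x = 0 := by
      rw [← Measure.measure_univ_eq_zero, a.H_univ, h1, tsub_self]
    simp [h1, hH]

lemma lintegral_adjoin (x : S) {f : S × Bool → ℝ≥0∞} (hf : Measurable f) :
    ∫⁻ z, f z ∂a.adjoin x = a.s x * f (x, true) + (1 - a.s x) * f (x, false) := by
  rw [adjoin, Kernel.lintegral_id_prod hf]
  change ∫⁻ b, f (x, b) ∂(a.s x • Measure.dirac true + (1 - a.s x) • Measure.dirac false) = _
  simp

/-- The law of the split chain as a kernel in the initial state `X_0`. -/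
def splitK : Kernel S (ℕ → S × Bool) := pathK a.split ∘ₖ a.adjoin

instance : IsMarkovKernel a.splitK := by unfold splitK; infer_instance

lemma splitLaw_eq (lam : Measure S) : a.splitLaw lam = lam.bind a.splitK := by
  rw [splitLaw, pathMeasure_eq, Measure.comp_assoc, splitK]

lemma lintegral_splitLaw (lam : Measure S) {F : (ℕ → S × Bool) → ℝ≥0∞} (hF : Measurable F) :
    ∫⁻ ω, F ω ∂a.splitLaw lam = ∫⁻ x, ∫⁻ ω, F ω ∂a.splitK x ∂lam := by
  rw [splitLaw_eq, Measure.lintegral_bind a.splitK.aemeasurable hF.aemeasurable]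

instance (lam : Measure S) [IsProbabilityMeasure lam] : IsProbabilityMeasure (a.splitLaw lam) := by
  rw [splitLaw_eq]; infer_instance

instance (lam : Measure S) [SFinite lam] : SFinite (a.splitLaw lam) := by
  rw [splitLaw_eq]; infer_instance

/-- Decomposition of the law of the split chain at its first step. -/
theorem lintegral_splitK (x : S) {F : (ℕ → S × Bool) → ℝ≥0∞} (hF : Measurable F) :
    ∫⁻ ω, F ω ∂a.splitK x =
      a.s x * ∫⁻ ω, F (prepend (x, true) ω) ∂a.splitLaw a.ν +
        ∫⁻ y, ∫⁻ ω, F (prepend (x, false) ω) ∂a.splitK y ∂a.H x := by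
  have hp (z : S × Bool) : ∫⁻ ω, F ω ∂pathK a.split z =
      ∫⁻ y, ∫⁻ ω, F (prepend z ω) ∂a.splitK y ∂a.next z := by
    have hFz : Measurable fun ω => F (prepend z ω) := hF.comp (measurable_prepend_right z)
    have hs : a.split z = (a.adjoin ∘ₖ a.next) z := rfl
    rw [lintegral_pathK a.split z hF, hs, Kernel.lintegral_comp _ _ _ hFz.lintegral_kernel]
    refine lintegral_congr fun y => ?_
    rw [splitK, Kernel.lintegral_comp _ _ _ hFz]
  rw [splitK, Kernel.lintegral_comp _ _ _ hF, lintegral_adjoin _ _ hF.lintegral_kernel, hp, hp,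
    a.lintegral_splitLaw _ (hF.fun_comp (measurable_prepend_right _)), ← one_sub_mul_lintegral_Q]
  rfl

/-- The law of the state of the chain at a fixed time. -/
lemma lintegral_state (u : ℕ) (x : S) {f : S → ℝ≥0∞} (hf : Measurable f) :
    ∫⁻ ω, f (ω u).1 ∂a.splitK x = ∫⁻ y, f y ∂(P ^ u) x := by
  induction u generalizing x with
  | zero =>
    rw [a.lintegral_splitK x (by fun_prop)]
    simp only [prepend_zero, lintegral_const, measure_univ, mul_one, pow_zero]
    rw [H_univ, mul_comm (f x), ← add_mul, add_tsub_cancel_of_le (a.s_le_one x), one_mul]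
    exact (lintegral_dirac' x hf).symm
  | succ u ih =>
    rw [a.lintegral_splitK x (by fun_prop), pow_succ]
    simp only [prepend_succ]
    -- The future no longer depends on the first mark, so the branches `s ⊗ ν` and `H` recombine
    -- into `P`.
    rw [a.lintegral_splitLaw _ (by fun_prop), ← a.lintegral_P x]
    simp_rw [ih]
    exact (Kernel.lintegral_comp _ _ _ hf).symm

/-- The law of the future after a fixed time at which the mark is `0`. -/
lemma lintegral_shift_of_mark_false (u : ℕ) (x : S) {F : (ℕ → S × Bool) → ℝ≥0∞}
    (hF : Measurable F) :
    ∫⁻ ω, (if (ω u).2 = false then F (shift (u + 1) ω) else 0) ∂a.splitK x =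
      ∫⁻ ω, F ω ∂a.splitLaw ((a.H ∘ₖ (P ^ u)) x) := by
  have hm (u : ℕ) : Measurable fun ω : ℕ → S × Bool =>
      if (ω u).2 = false then F (shift (u + 1) ω) else 0 :=
    Measurable.ite (measurableSet_eq_fun (by fun_prop) measurable_const) (by fun_prop)
      measurable_const
  have hF' : Measurable fun y => ∫⁻ ω, F ω ∂a.splitK y := hF.lintegral_kernel
  rw [a.lintegral_splitLaw _ hF]
  refine Eq.trans ?_ (Kernel.lintegral_comp a.H (P ^ u) x hF').symm
  induction u generalizing x with
  | zero =>
    rw [a.lintegral_splitK x (hm 0)]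
    simp only [prepend_zero, Bool.true_eq_false, if_false, if_true, zero_add, shift_one_prepend,
      lintegral_zero, mul_zero, pow_zero]
    exact (lintegral_dirac' x hF'.lintegral_kernel).symm
  | succ u ih =>
    rw [a.lintegral_splitK x (hm _), pow_succ]
    change a.s x * ∫⁻ ω, (if (ω u).2 = false then F (shift (u + 1) ω) else 0) ∂a.splitLaw a.ν +
      ∫⁻ y, ∫⁻ ω, (if (ω u).2 = false then F (shift (u + 1) ω) else 0) ∂a.splitK y ∂a.H x = _
    rw [a.lintegral_splitLaw _ (hm u), ← a.lintegral_P x]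
    simp_rw [ih]
    exact (Kernel.lintegral_comp _ _ _ hF'.lintegral_kernel).symm

/-- Regeneration: given the past and that the mark is `1` at time `u`, the future after `u` is a
split chain with initial law `ν`. -/
theorem lintegral_of_mark_true (u : ℕ) (lam : Measure S) {A B : (ℕ → S × Bool) → ℝ≥0∞}
    (hA : Measurable A) (hB : Measurable B) :
    ∫⁻ ω, (if (ω u).2 = true then A (stopAt u ω) * B (shift (u + 1) ω) else 0) ∂a.splitLaw lam =
      (∫⁻ ω, (if (ω u).2 = true then A (stopAt u ω) else 0) ∂a.splitLaw lam) *
        ∫⁻ ω, B ω ∂a.splitLaw a.ν := by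
  have hm (u : ℕ) {A : (ℕ → S × Bool) → ℝ≥0∞} (hA : Measurable A) : Measurable
      fun ω : ℕ → S × Bool =>
        if (ω u).2 = true then A (stopAt u ω) * B (shift (u + 1) ω) else 0 :=
    Measurable.ite (measurableSet_eq_fun (by fun_prop) measurable_const) (by fun_prop)
      measurable_const
  have hm' (u : ℕ) {A : (ℕ → S × Bool) → ℝ≥0∞} (hA : Measurable A) : Measurable
      fun ω : ℕ → S × Bool => if (ω u).2 = true then A (stopAt u ω) else 0 :=
    Measurable.ite (measurableSet_eq_fun (by fun_prop) measurable_const) (by fun_prop)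
      measurable_const
  rw [a.lintegral_splitLaw _ (hm u hA), a.lintegral_splitLaw _ (hm' u hA),
    ← lintegral_mul_const _ (hm' u hA).lintegral_kernel]
  refine lintegral_congr fun x => ?_
  -- `A` must vary: removing the first state `z` replaces it by `A ∘ prepend z`.
  induction u generalizing x A with
  | zero =>
    rw [a.lintegral_splitK x (hm 0 hA), a.lintegral_splitK x (hm' 0 hA)]
    simp only [prepend_zero, if_true, stopAt_zero_prepend, zero_add, shift_one_prepend,
      Bool.false_eq_true, if_false, lintegral_zero, add_zero, lintegral_const, measure_univ,
      mul_one]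
    rw [lintegral_const_mul _ hB, mul_assoc]
  | succ u ih =>
    rw [a.lintegral_splitK x (hm _ hA), a.lintegral_splitK x (hm' _ hA)]
    have hA' (z : S × Bool) : Measurable fun ω => A (prepend z ω) :=
      hA.comp (measurable_prepend_right z)
    simp only [prepend_succ, shift_succ_prepend, stopAt_succ_prepend]
    rw [a.lintegral_splitLaw a.ν (hm u (hA' _)), a.lintegral_splitLaw a.ν (hm' u (hA' _))]
    simp_rw [fun z => ih (hA' z)]
    rw [lintegral_mul_const _ (hm' u (hA' _)).lintegral_kernel,
      lintegral_mul_const _ (hm' u (hA' _)).lintegral_kernel, add_mul, mul_assoc]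

end Atom

end SplitChain

namespace SplitChain

/-! ### Regeneration times and blocks of a fixed mark sequence -/

section FirstTime

/-- The first `t` with `p t`, and `⊤` if there is none. -/
def firstTime (p : ℕ → Prop) : ℕ∞ := ⨅ (t : ℕ) (_ : p t), (t : ℕ∞)

variable {p q : ℕ → Prop}

lemma le_firstTime {a : ℕ∞} : a ≤ firstTime p ↔ ∀ t : ℕ, p t → a ≤ t := by
  simp [firstTime]

lemma firstTime_le {t : ℕ} (h : p t) : firstTime p ≤ t := le_firstTime.1 le_rfl t h

lemma firstTime_eq_top : firstTime p = ⊤ ↔ ∀ t, ¬ p t := by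
  simp [firstTime, iInf_eq_top]

lemma firstTime_eq_coe_iff {n : ℕ} : firstTime p = n ↔ p n ∧ ∀ i < n, ¬ p i := by
  constructor
  · intro h
    have h2 : ∀ i < n, ¬ p i := fun i hi hp => by
      have := firstTime_le hp
      rw [h, Nat.cast_le] at this
      omega
    refine ⟨?_, h2⟩
    by_contra hn
    have h3 : ((n + 1 : ℕ) : ℕ∞) ≤ firstTime p := le_firstTime.2 fun t ht => by
      rw [Nat.cast_le]
      by_contra hlt
      rcases Nat.lt_or_ge t n with h4 | h4
      · exact h2 t h4 ht
      · exact hn ((show t = n by omega) ▸ ht)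
    rw [h, Nat.cast_le] at h3
    omega
  · rintro ⟨h1, h2⟩
    refine le_antisymm (firstTime_le h1) (le_firstTime.2 fun t ht => ?_)
    rw [Nat.cast_le]
    by_contra hlt
    exact h2 t (not_le.1 hlt) ht

lemma le_firstTime_iff {n : ℕ} : (n : ℕ∞) ≤ firstTime p ↔ ∀ i < n, ¬ p i := by
  rw [le_firstTime]
  refine forall_congr' fun t => ?_
  rw [Nat.cast_le, ← not_lt]
  tauto

lemma firstTime_eq_add (c : ℕ) (h : ∀ t, p t ↔ ∃ t', t = t' + c ∧ q t') :
    firstTime p = firstTime q + c := by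
  rcases eq_or_ne (firstTime q) ⊤ with hq | hq
  · rw [hq, top_add, firstTime_eq_top]
    rintro t ht
    obtain ⟨t', -, ht'⟩ := (h t).1 ht
    exact firstTime_eq_top.1 hq t' ht'
  · obtain ⟨n, hn⟩ := ENat.ne_top_iff_exists.1 hq
    obtain ⟨h1, h2⟩ := firstTime_eq_coe_iff.1 hn.symm
    rw [← hn, ← Nat.cast_add, firstTime_eq_coe_iff]
    refine ⟨(h _).2 ⟨n, rfl, h1⟩, fun i hi hp => ?_⟩
    obtain ⟨t', rfl, ht'⟩ := (h i).1 hp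
    exact h2 t' (by omega) ht'

lemma measurable_firstTime {Ω : Type*} [MeasurableSpace Ω] {p : Ω → ℕ → Prop}
    (hp : ∀ t, MeasurableSet {ω | p ω t}) : Measurable fun ω => firstTime (p ω) := by
  refine measurable_to_countable fun ω => ?_
  have hfin (n : ℕ) : MeasurableSet {ω | firstTime (p ω) = n} := by
    simp only [firstTime_eq_coe_iff, Set.ofPred_and, Set.ofPred_forall]
    exact (hp n).inter (MeasurableSet.iInter fun i => MeasurableSet.iInter fun _ => (hp i).compl)
  change MeasurableSet {ω' | firstTime (p ω') = firstTime (p ω)}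
  rcases eq_or_ne (firstTime (p ω)) ⊤ with h | h
  · rw [h]
    simp only [firstTime_eq_top, Set.ofPred_forall]
    exact MeasurableSet.iInter fun i => (hp i).compl
  · obtain ⟨n, hn⟩ := ENat.ne_top_iff_exists.1 h
    rw [← hn]
    exact hfin n

end FirstTime

section RegTime

variable {y : ℕ → Bool} {u : ℕ}

lemma regTime_zero (y : ℕ → Bool) : regTime y 0 = firstTime fun t => y t = true := rfl

lemma regTime_succ (y : ℕ → Bool) (k : ℕ) :
    regTime y (k + 1) = firstTime fun t => regTime y k < t ∧ y t = true := by
  simp only [regTime, firstTime, iInf_and]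

lemma regTime_zero_eq_coe_iff : regTime y 0 = u ↔ y u = true ∧ ∀ i < u, y i = false := by
  rw [regTime_zero, firstTime_eq_coe_iff]
  simp

lemma regTime_zero_eq_top_iff : regTime y 0 = ⊤ ↔ ∀ i, y i = false := by
  rw [regTime_zero, firstTime_eq_top]
  simp

lemma coe_lt_add_iff {R : ℕ∞} {c t : ℕ} :
    R + c < (t : ℕ∞) ↔ ∃ t', t = t' + c ∧ R < (t' : ℕ∞) := by
  induction R using ENat.recTopCoe with
  | top => simp
  | coe n =>
    rw [← Nat.cast_add, Nat.cast_lt]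
    simp only [Nat.cast_lt]
    exact ⟨fun h => ⟨t - c, by omega, by omega⟩, fun ⟨t', h1, h2⟩ => by omega⟩

/-- Deterministic form of regeneration, which reduces later blocks to earlier ones of a shifted
path. The shift is `u + 1` because a block contains its right endpoint and not its left one. -/
lemma regTime_succ_of_eq (h : regTime y 0 = u) (k : ℕ) :
    regTime y (k + 1) = regTime (shift (u + 1) y) k + (u + 1 : ℕ) := by
  induction k with
  | zero =>
    rw [regTime_succ, h, regTime_zero]
    refine firstTime_eq_add _ fun t => ?_
    rw [Nat.cast_lt]
    constructor
    · rintro ⟨h1, h2⟩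
      refine ⟨t - (u + 1), by omega, ?_⟩
      simpa [shift, show t - (u + 1) + (u + 1) = t by omega] using h2
    · rintro ⟨t', rfl, h2⟩
      exact ⟨by omega, h2⟩
  | succ k ih =>
    rw [regTime_succ y, regTime_succ (shift (u + 1) y), ih]
    refine firstTime_eq_add _ fun t => ?_
    rw [coe_lt_add_iff]
    constructor
    · rintro ⟨⟨t', rfl, h1⟩, h2⟩
      exact ⟨t', rfl, h1, h2⟩
    · rintro ⟨t', rfl, h1, h2⟩
      exact ⟨⟨t', rfl, h1⟩, h2⟩

lemma regTime_eq_top_of_zero (h : regTime y 0 = ⊤) (k : ℕ) : regTime y k = ⊤ := by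
  cases k with
  | zero => exact h
  | succ k =>
    rw [regTime_succ, firstTime_eq_top]
    exact fun t ht => by simp [regTime_zero_eq_top_iff.1 h t] at ht

lemma regTime_le_succ (y : ℕ → Bool) (k : ℕ) : regTime y k ≤ regTime y (k + 1) := by
  rw [regTime_succ, le_firstTime]
  exact fun t ht => ht.1.le

lemma regTime_mono (y : ℕ → Bool) : Monotone (regTime y) :=
  monotone_nat_of_le_succ (regTime_le_succ y)

lemma measurable_regTime (k : ℕ) : Measurable fun y : ℕ → Bool => regTime y k := by
  have hy (t : ℕ) : MeasurableSet {y : ℕ → Bool | y t = true} :=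
    measurableSet_eq_fun (by fun_prop) measurable_const
  induction k with
  | zero => exact measurable_firstTime hy
  | succ k ih =>
    simp only [regTime_succ]
    exact measurable_firstTime fun t => (ih (MeasurableSet.of_discrete (s := Set.Iio (t : ℕ∞)))).inter
      (hy t)

end RegTime

section Block

variable {y : ℕ → Bool} {u : ℕ}

lemma mem_block_succ {k t : ℕ} :
    t ∈ block y (k + 1) ↔ regTime y k < t ∧ (t : ℕ∞) ≤ regTime y (k + 1) := Iff.rfl

lemma mem_block_zero {t : ℕ} : t ∈ block y 0 ↔ ∀ i < t, y i = false := by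
  change (t : ℕ∞) ≤ regTime y 0 ↔ _
  rw [regTime_zero, le_firstTime_iff]
  simp

lemma block_succ_of_eq (h : regTime y 0 = u) (k : ℕ) :
    block y (k + 1) = (fun t => t + (u + 1)) '' block (shift (u + 1) y) k := by
  ext t
  simp only [Set.mem_image, mem_block_succ, regTime_succ_of_eq h k]
  -- Block `0` is separate: it has no preceding regeneration time in `ℕ∞`.
  cases k with
  | zero =>
    rw [h, Nat.cast_lt]
    constructor
    · rintro ⟨h1, h2⟩
      refine ⟨t - (u + 1), ?_, by omega⟩
      change ((t - (u + 1) : ℕ) : ℕ∞) ≤ _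
      rw [← ENat.add_le_add_iff_right (ENat.natCast_ne_top (u + 1)), ← Nat.cast_add]
      rwa [show t - (u + 1) + (u + 1) = t by omega]
    · rintro ⟨t', h1, rfl⟩
      refine ⟨by omega, ?_⟩
      push_cast
      gcongr
      exact h1
  | succ k =>
    rw [regTime_succ_of_eq h k, coe_lt_add_iff]
    constructor
    · rintro ⟨⟨t', rfl, h1⟩, h2⟩
      refine ⟨t', ⟨h1, ?_⟩, rfl⟩
      rwa [Nat.cast_add, ENat.add_le_add_iff_right (ENat.natCast_ne_top (u + 1))] at h2
    · rintro ⟨t', ⟨h1, h2⟩, rfl⟩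
      refine ⟨⟨t', rfl, h1⟩, ?_⟩
      rw [Nat.cast_add]
      gcongr

lemma block_succ_of_top (h : regTime y 0 = ⊤) (k : ℕ) : block y (k + 1) = ∅ := by
  ext t
  simp [mem_block_succ, regTime_eq_top_of_zero h k]

lemma pairwise_disjoint_block (y : ℕ → Bool) : Pairwise (Function.onFun Disjoint (block y)) := by
  have hle {k t : ℕ} (h : t ∈ block y k) : (t : ℕ∞) ≤ regTime y k := by
    cases k with
    | zero => exact h
    | succ k => exact h.2
  refine (pairwise_disjoint_on _).2 fun i j hij => ?_
  obtain ⟨j, rfl⟩ := Nat.exists_eq_succ_of_ne_zero (Nat.ne_zero_of_lt hij)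
  refine Set.disjoint_left.2 fun t hi hj => ?_
  exact absurd ((hle hi).trans (regTime_mono y (Nat.le_of_lt_succ hij))) (not_le.2 hj.1)

lemma blockSum_succ_of_eq (h : regTime y 0 = u) (f : ℕ → ℝ) (k : ℕ) :
    blockSum y f (k + 1) = blockSum (shift (u + 1) y) (shift (u + 1) f) k := by
  rw [blockSum, block_succ_of_eq h]
  exact tsum_image f (add_left_injective _).injOn

lemma blockSum_succ_of_top (h : regTime y 0 = ⊤) (f : ℕ → ℝ) (k : ℕ) :
    blockSum y f (k + 1) = 0 := by
  rw [blockSum, block_succ_of_top h]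
  simp

lemma measurableSet_mem_block (k t : ℕ) : MeasurableSet {y : ℕ → Bool | t ∈ block y k} := by
  cases k with
  | zero => exact measurable_regTime 0 (MeasurableSet.of_discrete (s := Set.Ici (t : ℕ∞)))
  | succ k =>
    exact (measurable_regTime k (MeasurableSet.of_discrete (s := Set.Iio (t : ℕ∞)))).inter
      (measurable_regTime (k + 1) (MeasurableSet.of_discrete (s := Set.Ici (t : ℕ∞))))

lemma measurable_blockSum {Ω : Type*} [MeasurableSpace Ω] {y : Ω → ℕ → Bool} {f : Ω → ℕ → ℝ}
    (hy : Measurable y) (hf : ∀ t, Measurable fun ω => f ω t) (k : ℕ) :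
    Measurable fun ω => blockSum (y ω) (f ω) k := by
  classical
  simp only [blockSum, tsum_subtype, Set.indicator_apply]
  exact Measurable.tsum fun t =>
    Measurable.ite (hy (measurableSet_mem_block k t)) (hf t) measurable_const

end Block

end SplitChain

namespace SplitChain

/-! ### Weighted Jensen inequality and pathwise bounds for sub-blocks -/

section WeightedHolder

/-- Jensen's inequality for weighted series in `[0, ∞]`. -/
lemma tsum_mul_rpow_le {ι : Type*} (a f : ι → ℝ≥0∞) {m : ℝ} (hm : 1 ≤ m) :
    (∑' i, a i * f i) ^ m ≤ ∑' i, a i * (∑' j, a j) ^ (m - 1) * f i ^ m := by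
  have hm0 : 0 < m := by linarith
  have h1 : ∑' i, a i * f i ≤
      (∑' i, a i) ^ (1 - m⁻¹) * (∑' i, a i * f i ^ m) ^ m⁻¹ := by
    -- Weighted Hölder is applied to finite sums, whose bounds are then enlarged to the full series.
    rw [ENNReal.tsum_eq_iSup_sum]
    refine iSup_le fun s => (ENNReal.inner_le_weight_mul_Lp_of_nonneg s hm a f).trans ?_
    have : 0 ≤ 1 - m⁻¹ := sub_nonneg.2 (inv_le_one_of_one_le₀ hm)
    gcongr <;> exact ENNReal.sum_le_tsum s
  refine (ENNReal.rpow_le_rpow h1 hm0.le).trans (le_of_eq ?_)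
  rw [ENNReal.mul_rpow_of_nonneg _ _ hm0.le, ← ENNReal.rpow_mul, ← ENNReal.rpow_mul,
    inv_mul_cancel₀ hm0.ne', ENNReal.rpow_one, sub_mul, inv_mul_cancel₀ hm0.ne', one_mul,
    ← ENNReal.tsum_mul_left]
  exact tsum_congr fun i => by ring

end WeightedHolder

variable {E₁ E₂ : Type*}

/-- The simultaneous shift of two paths. -/
def shiftPair (n : ℕ) (ω : (ℕ → E₁ × Bool) × (ℕ → E₂ × Bool)) :
    (ℕ → E₁ × Bool) × (ℕ → E₂ × Bool) := (shift n ω.1, shift n ω.2)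

/-- The first time at which the mark of a path is `1`. -/
def hit (x : ℕ → E₁ × Bool) : ℕ∞ := regTime (fun t => (x t).2) 0

/-- The first time at which both marks are `1`. -/
def hitPair (ω : (ℕ → E₁ × Bool) × (ℕ → E₂ × Bool)) : ℕ∞ :=
  regTime (fun t => (ω.1 t).2 && (ω.2 t).2) 0

section Recursion

variable {ω : (ℕ → E₁ × Bool) × (ℕ → E₂ × Bool)} {u : ℕ}

lemma T_of_true (h : hit ω.1 = u) (h2 : (ω.2 u).2 = true) : T ω = 0 :=
  firstTime_eq_coe_iff.2 ⟨⟨u, h, h2⟩, by simp⟩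

lemma T_of_false (h : hit ω.1 = u) (h2 : (ω.2 u).2 = false) :
    T ω = T (shiftPair (u + 1) ω) + 1 := by
  refine firstTime_eq_add 1 fun j => ?_
  have key (j : ℕ) : regTime (fun i => (ω.1 i).2) (j + 1) =
      regTime (fun i => ((shiftPair (u + 1) ω).1 i).2) j + (u + 1 : ℕ) := regTime_succ_of_eq h j
  constructor
  · rintro ⟨t, ht, h3⟩
    cases j with
    | zero =>
      have : (u : ℕ∞) = t := h.symm.trans ht
      rw [Nat.cast_inj] at this
      rw [← this, h2] at h3
      exact absurd h3 (by simp)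
    | succ j =>
      refine ⟨j, rfl, ?_⟩
      rw [key] at ht
      have hne : regTime (fun i => ((shiftPair (u + 1) ω).1 i).2) j ≠ ⊤ := by
        intro h4
        rw [h4, top_add] at ht
        simp at ht
      obtain ⟨n, hn⟩ := ENat.ne_top_iff_exists.1 hne
      refine ⟨n, hn.symm, ?_⟩
      rw [← hn, ← Nat.cast_add, Nat.cast_inj] at ht
      change (ω.2 (n + (u + 1))).2 = true
      rwa [ht]
  · rintro ⟨j, rfl, t, ht, h3⟩
    refine ⟨t + (u + 1), ?_, h3⟩
    rw [key, ht]
    rfl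

lemma V_succ_of_eq (g : E₁ → E₂ → ℝ) (h : hit ω.1 = u) (j : ℕ) :
    V g (j + 1) ω = V g j (shiftPair (u + 1) ω) :=
  blockSum_succ_of_eq h _ j

lemma V_succ_of_top (g : E₁ → E₂ → ℝ) (h : hit ω.1 = ⊤) (j : ℕ) : V g (j + 1) ω = 0 :=
  blockSum_succ_of_top h _ j

lemma U_succ_of_eq (g : E₁ → E₂ → ℝ) (h : hitPair ω = u) (k : ℕ) :
    U g (k + 1) ω = U g k (shiftPair (u + 1) ω) :=
  blockSum_succ_of_eq h _ k

lemma U_succ_of_top (g : E₁ → E₂ → ℝ) (h : hitPair ω = ⊤) (k : ℕ) : U g (k + 1) ω = 0 :=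
  blockSum_succ_of_top h _ k

lemma U₁_succ_of_eq (f : E₁ → ℝ) {x : ℕ → E₁ × Bool} (h : hit x = u) (k : ℕ) :
    U₁ f (k + 1) x = U₁ f k (shift (u + 1) x) :=
  blockSum_succ_of_eq h _ k

/-- The `j`-th term of `sumV`. -/
def sumVTerm (g : E₁ → E₂ → ℝ) (r : ℝ) (j : ℕ) (ω : (ℕ → E₁ × Bool) × (ℕ → E₂ × Bool)) : ℝ≥0∞ :=
  open Classical in if (j : ℕ∞) ≤ T ω then ‖V g j ω‖ₑ ^ r else 0

lemma sumVTerm_zero (g : E₁ → E₂ → ℝ) (r : ℝ) : sumVTerm g r 0 ω = ‖V g 0 ω‖ₑ ^ r := by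
  simp [sumVTerm]

/-- At most one term of the series is nonzero, namely `u = hit ω.1`; the series form permits
integration at fixed times. If `hit ω.1 = ⊤`, block `j + 1` is empty and its term is `0` because `0
< r`. -/
lemma sumVTerm_succ (g : E₁ → E₂ → ℝ) {r : ℝ} (hr : 0 < r) (j : ℕ) :
    sumVTerm g r (j + 1) ω = ∑' u : ℕ, if hit ω.1 = u then
      (if (ω.2 u).2 = false then sumVTerm g r j (shiftPair (u + 1) ω) else 0) else 0 := by
  rcases eq_or_ne (hit ω.1) ⊤ with h | h
  · simp [sumVTerm, V_succ_of_top g h, h, hr]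
  · obtain ⟨u, hu⟩ := ENat.ne_top_iff_exists.1 h
    rw [tsum_eq_single u fun v hv => if_neg (by rw [← hu, Nat.cast_inj]; exact hv.symm),
      if_pos hu.symm]
    cases h2 : (ω.2 u).2 with
    | false =>
      have hT : ((j + 1 : ℕ) : ℕ∞) ≤ T ω ↔ (j : ℕ∞) ≤ T (shiftPair (u + 1) ω) := by
        rw [T_of_false hu.symm h2, Nat.cast_add, Nat.cast_one,
          ENat.add_le_add_iff_right ENat.one_ne_top]
      simp only [if_true, sumVTerm, V_succ_of_eq g hu.symm, hT]
    | true => simp [sumVTerm, T_of_true hu.symm h2]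

/-- The sum of `|V_j|^r` over `j < N` with `j ≤ 𝒯`. -/
def sumVPartial (g : E₁ → E₂ → ℝ) (r : ℝ) (N : ℕ)
    (ω : (ℕ → E₁ × Bool) × (ℕ → E₂ × Bool)) : ℝ≥0∞ := ∑ j ∈ Finset.range N, sumVTerm g r j ω

/-- The renewal recursion: after the first sub-block the same partial sum restarts on the shifted
pair, provided that the second mark was `0`. -/
lemma sumVPartial_succ (g : E₁ → E₂ → ℝ) {r : ℝ} (hr : 0 < r) (N : ℕ) :
    sumVPartial g r (N + 1) ω = ‖V g 0 ω‖ₑ ^ r + ∑' u : ℕ, if hit ω.1 = u then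
      (if (ω.2 u).2 = false then sumVPartial g r N (shiftPair (u + 1) ω) else 0) else 0 := by
  rw [sumVPartial, Finset.sum_range_succ', add_comm, sumVTerm_zero]
  congr 1
  simp only [sumVTerm_succ g hr]
  rw [← Summable.tsum_finsetSum fun _ _ => ENNReal.summable]
  refine tsum_congr fun u => ?_
  split_ifs <;> simp [sumVPartial]

lemma sumV_eq_iSup (g : E₁ → E₂ → ℝ) (r : ℝ) : sumV g r ω = ⨆ N, sumVPartial g r N ω :=
  ENNReal.tsum_eq_iSup_nat

end Recursion

section CompoundBlock

lemma exists_mem_block (y : ℕ → Bool) (t : ℕ) : ∃ j, t ∈ block y j := by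
  induction t using Nat.strong_induction_on generalizing y with
  | _ t ih =>
    by_cases h : t ∈ block y 0
    · exact ⟨0, h⟩
    · have hlt : regTime y 0 < t := not_le.1 h
      obtain ⟨u, hu⟩ := ENat.ne_top_iff_exists.1 (ne_top_of_lt hlt)
      rw [← hu, Nat.cast_lt] at hlt
      obtain ⟨j, hj⟩ := ih (t - (u + 1)) (by omega) (shift (u + 1) y)
      refine ⟨j + 1, ?_⟩
      rw [block_succ_of_eq hu.symm]
      exact ⟨_, hj, by simp only; omega⟩

/-- Compound regenerations are the X-regenerations at which the second mark is also `1`, so the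
first compound block is made of the sub-blocks with index at most `T ω`. The induction removes the
first sub-block. -/
lemma mem_block_pair_iff (ω : (ℕ → E₁ × Bool) × (ℕ → E₂ × Bool)) {j t : ℕ}
    (h : t ∈ block (fun i => (ω.1 i).2) j) :
    t ∈ block (fun i => (ω.1 i).2 && (ω.2 i).2) 0 ↔ (j : ℕ∞) ≤ T ω := by
  rw [mem_block_zero]
  induction j generalizing ω t with
  | zero =>
    rw [mem_block_zero] at h
    simp only [Nat.cast_zero, zero_le, iff_true]
    exact fun i hi => by simp [h i hi]
  | succ j ih =>
    rcases eq_or_ne (hit ω.1) ⊤ with hu | hu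
    · rw [block_succ_of_top hu] at h
      exact absurd h (Set.notMem_empty t)
    obtain ⟨u, hu⟩ := ENat.ne_top_iff_exists.1 hu
    rw [block_succ_of_eq hu.symm] at h
    obtain ⟨t', ht', rfl⟩ := h
    have hyu := regTime_zero_eq_coe_iff.1 hu.symm
    cases h2 : (ω.2 u).2 with
    | true =>
      rw [T_of_true hu.symm h2]
      constructor
      · intro h3
        have := h3 u (by simp only; omega)
        simp [h2, hyu.1] at this
      · intro h3
        simp at h3
    | false =>
      rw [T_of_false hu.symm h2, Nat.cast_add, Nat.cast_one,
        ENat.add_le_add_iff_right ENat.one_ne_top, ← ih (shiftPair (u + 1) ω) ht']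
      constructor
      · exact fun h3 i hi => h3 (i + (u + 1)) (by simp only; omega)
      · intro h3 i hi
        rcases lt_trichotomy i u with h4 | rfl | h4
        · simp [hyu.2 i h4]
        · simp [h2]
        · have := h3 (i - (u + 1)) (by simp only at hi; omega)
          simpa only [shiftPair, shift, show i - (u + 1) + (u + 1) = i by omega] using this

lemma enorm_U_zero_le (g : E₁ → E₂ → ℝ) (ω : (ℕ → E₁ × Bool) × (ℕ → E₂ × Bool)) :
    ‖U g 0 ω‖ₑ ≤ ∑' j : ℕ, sumVTerm g 1 j ω := by
  classical
  let C : ℕ → Set ℕ := fun j => if (j : ℕ∞) ≤ T ω then block (fun i => (ω.1 i).2) j else ∅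
  have hC : block (fun i => (ω.1 i).2 && (ω.2 i).2) 0 = ⋃ j, C j := by
    ext t
    obtain ⟨j, hj⟩ := exists_mem_block (fun i => (ω.1 i).2) t
    rw [Set.mem_iUnion]
    constructor
    · intro h
      exact ⟨j, by simp only [C]; rwa [if_pos ((mem_block_pair_iff ω hj).1 h)]⟩
    · rintro ⟨i, hi⟩
      by_cases h : (i : ℕ∞) ≤ T ω
      · simp only [C, if_pos h] at hi
        exact (mem_block_pair_iff ω hi).2 h
      · simp [C, if_neg h] at hi
  have hdisj : Pairwise (Function.onFun Disjoint C) := fun i j hij => by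
    have hsub (j : ℕ) : C j ⊆ block (fun i => (ω.1 i).2) j := by
      simp only [C]
      split_ifs <;> simp
    exact (pairwise_disjoint_block _ hij).mono (hsub i) (hsub j)
  have hterm (j : ℕ) : ‖∑' t : C j, g (ω.1 t).1 (ω.2 t).1‖ₑ = sumVTerm g 1 j ω := by
    by_cases h : (j : ℕ∞) ≤ T ω
    · have hCj : C j = block (fun i => (ω.1 i).2) j := if_pos h
      rw [hCj, sumVTerm, if_pos h, ENNReal.rpow_one]
      rfl
    · simp [C, if_neg h, sumVTerm]
  rw [U, blockSum, hC]
  by_cases hs : Summable fun t : ⋃ j, C j => g (ω.1 t).1 (ω.2 t).1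
  · have := (Equiv.summable_iff (Set.unionEqSigmaOfDisjoint hdisj).symm).2 hs
    rw [← (Set.unionEqSigmaOfDisjoint hdisj).symm.tsum_eq]
    refine (le_of_eq (congrArg (fun z : ℝ => ‖z‖ₑ) (Summable.tsum_sigma this))).trans ?_
    refine enorm_tsum_le_tsum_enorm.trans (le_of_eq (tsum_congr fun j => ?_))
    rw [← hterm]
    rfl
  -- A divergent block sum is `0` by convention, so the bound still holds.
  · rw [tsum_eq_zero_of_not_summable hs]
    simp

/-- The `p`-th power of a compound block in terms of `sumV` and the number `𝒯` of sub-blocks. -/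
lemma enorm_U_zero_rpow_le (g : E₁ → E₂ → ℝ) {p r : ℝ} (hp : 0 < p) (hr : 0 < r)
    (ω : (ℕ → E₁ × Bool) × (ℕ → E₂ × Bool)) :
    ‖U g 0 ω‖ₑ ^ p ≤ sumV g r ω ^ (p / r) * ((T ω : ℝ≥0∞) + 1) ^ p := by
  classical
  -- Bounding each term by the whole `r`-sum, instead of using convexity, avoids requiring `1 ≤ r`.
  have hle (j : ℕ) : sumVTerm g 1 j ω ≤ sumV g r ω ^ (1 / r) := by
    by_cases h : (j : ℕ∞) ≤ T ω
    · have h1 : ‖V g j ω‖ₑ ^ r ≤ sumV g r ω := by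
        refine le_trans (le_of_eq ?_) (ENNReal.le_tsum j)
        rw [if_pos h]
      rw [sumVTerm, if_pos h, ENNReal.rpow_one]
      calc ‖V g j ω‖ₑ = (‖V g j ω‖ₑ ^ r) ^ (1 / r) := by
            rw [← ENNReal.rpow_mul, mul_one_div_cancel hr.ne', ENNReal.rpow_one]
        _ ≤ _ := by gcongr
    · simp [sumVTerm, if_neg h]
  have hsum : ∑' j : ℕ, sumVTerm g 1 j ω ≤ sumV g r ω ^ (1 / r) * ((T ω : ℝ≥0∞) + 1) := by
    -- If `T ω = ⊤` the right side is `∞` unless its first factor is `0`, and in that case every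
    -- term on the left is `0`.
    rcases eq_or_ne (T ω) ⊤ with hT | hT
    · rw [hT]
      rcases eq_or_ne (sumV g r ω ^ (1 / r)) 0 with h0 | h0
      · rw [h0] at hle
        simp [fun j => le_antisymm (hle j) zero_le]
      · rw [ENat.toENNReal_top, top_add, ENNReal.mul_top h0]
        exact le_top
    · obtain ⟨n, hn⟩ := ENat.ne_top_iff_exists.1 hT
      have hz : ∀ j ∉ Finset.range (n + 1), sumVTerm g 1 j ω = 0 := fun j hj => by
        rw [sumVTerm, if_neg]
        rw [← hn, Nat.cast_le]
        simpa using hj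
      rw [tsum_eq_sum hz]
      refine (Finset.sum_le_card_nsmul _ _ _ fun j _ => hle j).trans (le_of_eq ?_)
      rw [← hn, Finset.card_range, nsmul_eq_mul, mul_comm]
      simp
  calc ‖U g 0 ω‖ₑ ^ p ≤ (sumV g r ω ^ (1 / r) * ((T ω : ℝ≥0∞) + 1)) ^ p := by
        gcongr
        exact (enorm_U_zero_le g ω).trans hsum
    _ = _ := by
        rw [ENNReal.mul_rpow_of_nonneg _ _ hp.le, ← ENNReal.rpow_mul]
        ring_nf

end CompoundBlock

section FirstBlock

variable (gX : E₁ → ℝ) (gW : E₂ → ℝ)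

/-- The summand `|g(X_t)|` of the first block, extended by `0` to all times. -/
def blockTerm (t : ℕ) (x : ℕ → E₁ × Bool) : ℝ≥0∞ :=
  if (t : ℕ∞) ≤ hit x then ‖gX (x t).1‖ₑ else 0

/-- The sum of `|g(X_t)|` over the first block, as an element of `[0, ∞]`. -/
def blockMass (x : ℕ → E₁ × Bool) : ℝ≥0∞ := ∑' t : ℕ, blockTerm gX t x

/-- With the `|gX|` terms as Jensen weights, the power falls on `gW` alone and each summand is a
function of the first path times a function of the second, ready for independence. -/
lemma enorm_V_zero_rpow_le {m : ℝ} (hm : 1 ≤ m) (ω : (ℕ → E₁ × Bool) × (ℕ → E₂ × Bool)) :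
    ‖V (fun x w => gX x * gW w) 0 ω‖ₑ ^ m ≤
      ∑' t : ℕ, blockTerm gX t ω.1 * blockMass gX ω.1 ^ (m - 1) * ‖gW (ω.2 t).1‖ₑ ^ m := by
  classical
  refine le_trans (ENNReal.rpow_le_rpow ?_ (by linarith)) (tsum_mul_rpow_le _ _ hm)
  rw [V, blockSum, tsum_subtype (block (fun t => (ω.1 t).2) 0)
    (fun t => gX (ω.1 t).1 * gW (ω.2 t).1)]
  refine enorm_tsum_le_tsum_enorm.trans (le_of_eq (tsum_congr fun t => ?_))
  rw [Set.indicator_apply, blockTerm]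
  by_cases h : (t : ℕ∞) ≤ hit ω.1
  · rw [if_pos h, if_pos (show t ∈ block (fun t => (ω.1 t).2) 0 from h), enorm_mul]
  · rw [if_neg h, if_neg (show t ∉ block (fun t => (ω.1 t).2) 0 from h)]
    simp

/-- Finiteness of the block matters: on an infinite block the real series may diverge and count as
`0`, while `blockMass` is `∞`. -/
lemma enorm_U₁_zero {x : ℕ → E₁ × Bool} (h : hit x ≠ ⊤) :
    ‖U₁ (fun z => |gX z|) 0 x‖ₑ = blockMass gX x := by
  classical
  obtain ⟨u, hu⟩ := ENat.ne_top_iff_exists.1 h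
  have hz : ∀ t ∉ Finset.range (u + 1),
      (block (fun t => (x t).2) 0).indicator (fun t => |gX (x t).1|) t = 0 := fun t ht => by
    refine Set.indicator_of_notMem ?_ _
    change ¬ (t : ℕ∞) ≤ hit x
    rw [← hu, Nat.cast_le]
    simpa using ht
  have hz' : ∀ t ∉ Finset.range (u + 1), blockTerm gX t x = 0 := fun t ht => by
    refine if_neg ?_
    rw [← hu, Nat.cast_le]
    simpa using ht
  rw [U₁, blockSum, tsum_subtype (block (fun t => (x t).2) 0) (fun t => |gX (x t).1|),
    blockMass, tsum_eq_sum hz, tsum_eq_sum hz', Real.enorm_eq_ofReal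
      (Finset.sum_nonneg fun t _ => Set.indicator_nonneg (fun _ _ => abs_nonneg _) _),
    ENNReal.ofReal_sum_of_nonneg fun t _ => Set.indicator_nonneg (fun _ _ => abs_nonneg _) _]
  refine Finset.sum_congr rfl fun t _ => ?_
  rw [Set.indicator_apply, blockTerm]
  by_cases h : (t : ℕ∞) ≤ hit x
  · rw [if_pos h, if_pos (show t ∈ block (fun t => (x t).2) 0 from h), Real.enorm_eq_ofReal_abs]
  · rw [if_neg h, if_neg (show t ∉ block (fun t => (x t).2) 0 from h)]
    simp

end FirstBlock

/-! ### Measurability of the path functionals -/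

section Measurability

variable [MeasurableSpace E₁] [MeasurableSpace E₂]

@[fun_prop]
lemma measurable_shiftPair (n : ℕ) :
    Measurable (shiftPair n : (ℕ → E₁ × Bool) × (ℕ → E₂ × Bool) → _) := by
  unfold shiftPair
  fun_prop

@[fun_prop]
lemma measurable_hit : Measurable (hit : (ℕ → E₁ × Bool) → ℕ∞) :=
  (measurable_regTime 0).comp (by fun_prop)

lemma measurable_mark_and : Measurable fun (ω : (ℕ → E₁ × Bool) × (ℕ → E₂ × Bool)) (t : ℕ) =>
    (ω.1 t).2 && (ω.2 t).2 :=
  measurable_pi_lambda _ fun t =>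
    (measurable_of_countable fun b : Bool × Bool => b.1 && b.2).comp
      (f := fun ω : (ℕ → E₁ × Bool) × (ℕ → E₂ × Bool) => ((ω.1 t).2, (ω.2 t).2)) (by fun_prop)

@[fun_prop]
lemma measurable_hitPair :
    Measurable (hitPair : (ℕ → E₁ × Bool) × (ℕ → E₂ × Bool) → ℕ∞) :=
  (measurable_regTime 0).comp measurable_mark_and

@[fun_prop]
lemma measurable_T : Measurable (T : (ℕ → E₁ × Bool) × (ℕ → E₂ × Bool) → ℕ∞) := by
  refine measurable_firstTime fun j => ?_
  have h : Measurable fun ω : (ℕ → E₁ × Bool) × (ℕ → E₂ × Bool) =>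
      regTime (fun i => (ω.1 i).2) j := (measurable_regTime j).comp (by fun_prop)
  simp only [Set.ofPred_exists, Set.ofPred_and]
  exact MeasurableSet.iUnion fun t => (h (MeasurableSet.singleton (t : ℕ∞))).inter
    (measurableSet_eq_fun (by fun_prop) measurable_const)

variable {g : E₁ → E₂ → ℝ}

lemma measurable_V (hg : Measurable fun p : E₁ × E₂ => g p.1 p.2) (j : ℕ) :
    Measurable (V g j) :=
  measurable_blockSum (by fun_prop) (fun t => hg.comp
    (g := fun p : E₁ × E₂ => g p.1 p.2)
    (f := fun ω : (ℕ → E₁ × Bool) × (ℕ → E₂ × Bool) => ((ω.1 t).1, (ω.2 t).1)) (by fun_prop)) j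

lemma measurable_U (hg : Measurable fun p : E₁ × E₂ => g p.1 p.2) (k : ℕ) :
    Measurable (U g k) :=
  measurable_blockSum measurable_mark_and (fun t => hg.comp
    (g := fun p : E₁ × E₂ => g p.1 p.2)
    (f := fun ω : (ℕ → E₁ × Bool) × (ℕ → E₂ × Bool) => ((ω.1 t).1, (ω.2 t).1)) (by fun_prop)) k

lemma measurable_U₁ {f : E₁ → ℝ} (hf : Measurable f) (k : ℕ) : Measurable (U₁ f k) :=
  measurable_blockSum (by fun_prop) (fun t => by fun_prop) k

lemma measurable_sumVTerm (hg : Measurable fun p : E₁ × E₂ => g p.1 p.2) (r : ℝ) (j : ℕ) :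
    Measurable (sumVTerm g r j) :=
  Measurable.ite (measurable_T (MeasurableSet.of_discrete (s := Set.Ici (j : ℕ∞))))
    ((measurable_V hg j).enorm.pow_const r) measurable_const

lemma measurable_sumVPartial (hg : Measurable fun p : E₁ × E₂ => g p.1 p.2) (r : ℝ) (N : ℕ) :
    Measurable (sumVPartial g r N) :=
  Finset.measurable_fun_sum _ fun j _ => measurable_sumVTerm hg r j

lemma measurable_sumV (hg : Measurable fun p : E₁ × E₂ => g p.1 p.2) (r : ℝ) :
    Measurable (sumV g r) :=
  Measurable.tsum fun j => measurable_sumVTerm hg r j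

lemma measurable_blockTerm {f : E₁ → ℝ} (hf : Measurable f) (t : ℕ) :
    Measurable (blockTerm f t) :=
  Measurable.ite (measurable_hit (MeasurableSet.of_discrete (s := Set.Ici (t : ℕ∞))))
    (by fun_prop) measurable_const

lemma measurable_blockMass {f : E₁ → ℝ} (hf : Measurable f) : Measurable (blockMass f) :=
  Measurable.tsum fun t => measurable_blockTerm hf t

end Measurability

end SplitChain

namespace SplitChain

/-! ### Almost sure regeneration of a Harris recurrent chain -/

section Recurrence

lemma hit_eq_coe_iff {E : Type*} {x : ℕ → E × Bool} {u : ℕ} :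
    hit x = u ↔ (x u).2 = true ∧ ∀ i < u, (x i).2 = false := regTime_zero_eq_coe_iff

lemma hit_eq_top_iff {E : Type*} {x : ℕ → E × Bool} :
    hit x = ⊤ ↔ ∀ i, (x i).2 = false := regTime_zero_eq_top_iff

lemma hit_prepend_true_ne_top {E : Type*} (x : E) (ω : ℕ → E × Bool) :
    hit (prepend (x, true) ω) ≠ ⊤ := by
  intro h
  simpa using hit_eq_top_iff.1 h 0

lemma hit_prepend_false_eq_top {E : Type*} (x : E) (ω : ℕ → E × Bool) :
    hit (prepend (x, false) ω) = ⊤ ↔ hit ω = ⊤ := by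
  rw [hit_eq_top_iff, hit_eq_top_iff]
  refine ⟨fun h i => h (i + 1), fun h i => ?_⟩
  cases i with
  | zero => rfl
  | succ i => exact h i

variable {S : Type*} [MeasurableSpace S] {P : Kernel S S} {φ : Measure S}

lemma measurableSet_hit_eq (c : ℕ∞) : MeasurableSet {x : ℕ → S × Bool | hit x = c} :=
  measurable_hit (MeasurableSet.singleton c)

lemma measurable_ite_hit {F : (ℕ → S × Bool) → ℝ≥0∞} (hF : Measurable F) (u : ℕ) :
    Measurable fun x => if hit x = u then F (shift (u + 1) x) else 0 :=
  Measurable.ite (measurableSet_hit_eq _) (by fun_prop) measurable_const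

namespace Atom

variable (a : Atom P φ)

/-- The set where `s` is nonzero is a countable union of level sets, which cannot all be null.
Recurrence is applied to one of them. -/
lemma exists_le_s : ∃ ε : ℝ≥0∞, ε ≠ 0 ∧ 0 < φ {x | ε ≤ a.s x} := by
  by_contra! h
  have h0 : φ (⋃ n : ℕ, {x | ((n : ℝ≥0∞) + 1)⁻¹ ≤ a.s x}) = 0 :=
    measure_iUnion_null fun n => le_antisymm (h _ (by simp)) zero_le
  refine a.support_pos.ne' (measure_mono_null (fun x hx => ?_) h0)
  obtain ⟨n, hn⟩ := ENNReal.exists_inv_nat_lt hx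
  refine Set.mem_iUnion.2 ⟨n, le_trans (ENNReal.inv_le_inv.2 ?_) hn.le⟩
  exact le_self_add

variable [IsMarkovKernel P]

/-- An initial mark `1` is already a regeneration, so only the mark-`0` branch, governed by `H`,
contributes. -/
lemma measure_hit_eq_top (x : S) :
    a.splitK x {ω | hit ω = ⊤} = ∫⁻ y, a.splitK y {ω | hit ω = ⊤} ∂a.H x := by
  have hS := measurableSet_hit_eq (S := S) ⊤
  rw [← lintegral_indicator_one hS, a.lintegral_splitK x (measurable_one.indicator hS)]
  simp only [Set.indicator_apply, Set.mem_ofPred_eq, hit_prepend_true_ne_top, if_false,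
    lintegral_zero, mul_zero, zero_add, hit_prepend_false_eq_top]
  refine lintegral_congr fun y => ?_
  rw [← lintegral_indicator_one hS]
  exact lintegral_congr fun ω => by simp [Set.indicator_apply]

/-- The probability of not visiting `A` before time `n`. -/
def avoid (P : Kernel S S) [IsMarkovKernel P] (A : Set S) (n : ℕ) (x : S) : ℝ≥0∞ :=
  pathK P x {ω | ∀ i < n, ω i ∉ A}

lemma measurableSet_avoid {A : Set S} (hA : MeasurableSet A) (n : ℕ) :
    MeasurableSet {ω : ℕ → S | ∀ i < n, ω i ∉ A} := by
  simp only [Set.ofPred_forall]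
  exact MeasurableSet.iInter fun i => MeasurableSet.iInter fun _ => (measurable_pi_apply i hA).compl

lemma measurable_avoid {A : Set S} (hA : MeasurableSet A) (n : ℕ) : Measurable (avoid P A n) :=
  (pathK P).measurable_coe (measurableSet_avoid hA n)

lemma avoid_succ {A : Set S} (hA : MeasurableSet A) (n : ℕ) {x : S} (hx : x ∉ A) :
    avoid P A (n + 1) x = ∫⁻ y, avoid P A n y ∂P x := by
  have hS := measurableSet_avoid hA
  rw [avoid, ← lintegral_indicator_one (hS (n + 1)),
    lintegral_pathK P x (measurable_one.indicator (hS (n + 1)))]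
  refine lintegral_congr fun y => ?_
  rw [avoid, ← lintegral_indicator_one (hS n)]
  refine lintegral_congr fun ω => ?_
  have : prepend x ω ∈ {ω : ℕ → S | ∀ i < n + 1, ω i ∉ A} ↔
      ω ∈ {ω : ℕ → S | ∀ i < n, ω i ∉ A} := by
    constructor
    · exact fun h i hi => h (i + 1) (by omega)
    · intro h i hi
      cases i with
      | zero => exact hx
      | succ i => exact h i (by omega)
  classical
  simp only [Set.indicator_apply, this]
  rfl

lemma tendsto_avoid {A : Set S} (hA : MeasurableSet A) {x : S}
    (h : ∀ᵐ ω ∂pathK P x, ∃ᶠ n in atTop, ω n ∈ A) :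
    Tendsto (fun n => avoid P A n x) atTop (𝓝 0) := by
  have h0 : pathK P x (⋂ n, {ω | ∀ i < n, ω i ∉ A}) = 0 := by
    refine measure_mono_null (fun ω hω => ?_) (ae_iff.1 h)
    intro hfreq
    obtain ⟨n, hn⟩ := hfreq.exists
    exact Set.mem_iInter.1 hω (n + 1) n (Nat.lt_succ_self n) hn
  rw [← h0]
  refine tendsto_measure_iInter_atTop (fun n => (measurableSet_avoid hA n).nullMeasurableSet)
    (fun m n hmn ω hω i hi => hω i (hi.trans_le hmn)) ⟨0, measure_ne_top _ _⟩

/-- The split chain of a Harris recurrent chain regenerates with probability one. -/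
theorem measure_hit_eq_top_eq_zero (hP : IsHarrisRecurrent P φ) (x : S) :
    a.splitK x {ω | hit ω = ⊤} = 0 := by
  obtain ⟨ε, hε, hpos⟩ := a.exists_le_s
  have hA : MeasurableSet {x | ε ≤ a.s x} := measurableSet_le measurable_const a.measurable_s
  set h : S → ℝ≥0∞ := fun x => a.splitK x {ω | hit ω = ⊤} with hh
  set M : ℝ≥0∞ := ⨆ x, h x
  have hM1 : M ≤ 1 := iSup_le fun x => prob_le_one
  -- On `{ε ≤ s}` the kernel `H` has mass at most `1 - ε`, so `h ≤ (1 - ε) M`; elsewhere `H ≤ P`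
  -- passes the bound to the next state.
  have hle (n : ℕ) (x : S) : h x ≤ (1 - ε) * M + M * avoid P {x | ε ≤ a.s x} n x := by
    induction n generalizing x with
    | zero => simpa [avoid] using (le_iSup h x).trans le_add_self
    | succ n ih =>
      by_cases hx : x ∈ {x | ε ≤ a.s x}
      · refine le_trans ?_ le_self_add
        calc h x = ∫⁻ y, h y ∂a.H x := a.measure_hit_eq_top x
          _ ≤ ∫⁻ _, M ∂a.H x := lintegral_mono fun y => le_iSup h y
          _ = (1 - a.s x) * M := by rw [lintegral_const, H_univ, mul_comm]
          _ ≤ _ := by gcongr; exact hx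
      · calc h x = ∫⁻ y, h y ∂a.H x := a.measure_hit_eq_top x
          _ ≤ ∫⁻ y, h y ∂P x := lintegral_mono' (a.H_le x) le_rfl
          _ ≤ ∫⁻ y, ((1 - ε) * M + M * avoid P {x | ε ≤ a.s x} n y) ∂P x := lintegral_mono ih
          _ = _ := by
            rw [lintegral_add_left measurable_const,
              lintegral_const_mul _ (measurable_avoid hA n), avoid_succ hA n hx]
            simp
  have hlim (x : S) : h x ≤ (1 - ε) * M := by
    have hrec := hP.recurrent x _ hA hpos
    rw [pathMeasure_dirac] at hrec
    have := ENNReal.Tendsto.const_mul (a := M) (tendsto_avoid hA hrec)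
      (Or.inr (ne_top_of_le_ne_top ENNReal.one_ne_top hM1))
    have h2 := this.const_add ((1 - ε) * M)
    rw [mul_zero, add_zero] at h2
    exact ge_of_tendsto' h2 fun n => hle n x
  -- Recurrence has removed the avoidance term, leaving `M ≤ (1 - ε) M` with `M` finite.
  have hM0 : M = 0 := by
    by_contra hne
    have h1 : (1 - ε) * M < 1 * M := by
      rw [ENNReal.mul_lt_mul_iff_left hne (ne_top_of_le_ne_top ENNReal.one_ne_top hM1)]
      exact ENNReal.sub_lt_self ENNReal.one_ne_top one_ne_zero hε
    rw [one_mul] at h1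
    exact (lt_irrefl M) ((iSup_le hlim).trans_lt h1)
  exact le_antisymm ((le_iSup h x).trans hM0.le) zero_le

lemma ae_hit_ne_top (hP : IsHarrisRecurrent P φ) (lam : Measure S) :
    ∀ᵐ ω ∂a.splitLaw lam, hit ω ≠ ⊤ := by
  rw [ae_iff, a.splitLaw_eq]
  simp only [not_not]
  rw [Measure.bind_apply (measurableSet_hit_eq ⊤) a.splitK.aemeasurable]
  simp [a.measure_hit_eq_top_eq_zero hP]

end Atom

end Recurrence

/-! ### Regeneration at the first marked time and the laws of later blocks -/

section Regeneration

variable {S : Type*} [MeasurableSpace S] {P : Kernel S S} [IsMarkovKernel P] {φ : Measure S}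

/-- The event is decided by the path up to `u`; the repeated mark condition gives the form required
by `Atom.lintegral_of_mark_true`. -/
lemma hit_eq_iff_stopAt {E : Type*} (x : ℕ → E × Bool) (u : ℕ) :
    hit x = u ↔ (x u).2 = true ∧ hit (stopAt u x) = u := by
  simp only [hit_eq_coe_iff, stopAt_apply_of_le le_rfl]
  refine ⟨fun h => ⟨h.1, h.1, fun i hi => ?_⟩, fun h => ⟨h.1, fun i hi => ?_⟩⟩
  · rw [stopAt_apply_of_le hi.le]
    exact h.2 i hi
  · have := h.2.2 i hi
    rwa [stopAt_apply_of_le hi.le] at this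

lemma hitPair_eq_iff_stopAt {E₁ E₂ : Type*}
    (ω : (ℕ → E₁ × Bool) × (ℕ → E₂ × Bool)) (u : ℕ) :
    hitPair ω = u ↔ (ω.1 u).2 = true ∧ (ω.2 u).2 = true ∧
      hitPair (stopAt u ω.1, stopAt u ω.2) = u := by
  simp only [hitPair, regTime_zero_eq_coe_iff, stopAt_apply_of_le le_rfl, Bool.and_eq_true]
  refine ⟨fun h => ⟨h.1.1, h.1.2, h.1, fun i hi => ?_⟩, fun h => ⟨h.2.2.1, fun i hi => ?_⟩⟩
  · rw [stopAt_apply_of_le hi.le, stopAt_apply_of_le hi.le]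
    exact h.2 i hi
  · have := h.2.2.2 i hi
    rwa [stopAt_apply_of_le hi.le, stopAt_apply_of_le hi.le] at this

/-- The split chain starts afresh after its first regeneration. -/
lemma Atom.lintegral_hit_eq (a : Atom P φ) (lam : Measure S) (u : ℕ) {F : (ℕ → S × Bool) → ℝ≥0∞}
    (hF : Measurable F) :
    ∫⁻ x, (if hit x = u then F (shift (u + 1) x) else 0) ∂a.splitLaw lam =
      a.splitLaw lam {x | hit x = u} * ∫⁻ x, F x ∂a.splitLaw a.ν := by
  have hS := measurableSet_hit_eq (S := S) u
  have h := a.lintegral_of_mark_true u lam (A := {x | hit x = u}.indicator 1)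
    (measurable_one.indicator hS) hF
  rw [← lintegral_indicator_one hS]
  convert h using 1
  · refine lintegral_congr fun x => ?_
    by_cases hm : (x u).2 = true <;> by_cases hs : hit (stopAt u x) = u <;>
      simp [hit_eq_iff_stopAt x u, hm, hs]
  · congr 1
    refine lintegral_congr fun x => ?_
    by_cases hm : (x u).2 = true <;> by_cases hs : hit (stopAt u x) = u <;>
      simp [hit_eq_iff_stopAt x u, hm, hs]

lemma tsum_measure_eq_coe_le_one {Ω : Type*} [MeasurableSpace Ω] (μ : Measure Ω)
    [IsProbabilityMeasure μ] {R : Ω → ℕ∞} (hR : Measurable R) :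
    ∑' u : ℕ, μ {ω | R ω = u} ≤ 1 := by
  have hmeas (u : ℕ) : MeasurableSet {ω | R ω = u} := hR (MeasurableSet.singleton (u : ℕ∞))
  rw [← measure_iUnion (fun i j hij => ?_) hmeas]
  · exact prob_le_one
  · refine Set.disjoint_left.2 fun ω hi hj => hij ?_
    exact Nat.cast_injective (R := ℕ∞) (hi.symm.trans hj)

lemma Atom.tsum_measure_hit_eq (a : Atom P φ) (hP : IsHarrisRecurrent P φ) (lam : Measure S)
    [IsProbabilityMeasure lam] : ∑' u : ℕ, a.splitLaw lam {x | hit x = u} = 1 := by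
  rw [← measure_iUnion (fun i j hij => ?_) fun u => measurableSet_hit_eq _]
  · rw [← prob_compl_eq_zero_iff (MeasurableSet.iUnion fun u => measurableSet_hit_eq _)]
    refine measure_mono_null (fun x hx => ?_) (ae_iff.1 (a.ae_hit_ne_top hP lam))
    intro hne
    refine hx ?_
    obtain ⟨u, hu⟩ := ENat.ne_top_iff_exists.1 hne
    exact Set.mem_iUnion.2 ⟨u, hu.symm⟩
  · refine Set.disjoint_left.2 fun ω hi hj => hij ?_
    exact Nat.cast_injective (R := ℕ∞) (hi.symm.trans hj)

/-- The law of a block `U_k`, `k ≥ 1`, of a single recurrent split chain. -/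
lemma Atom.lintegral_U₁_succ (a : Atom P φ) (hP : IsHarrisRecurrent P φ) (lam : Measure S)
    [IsProbabilityMeasure lam] {f : S → ℝ} (hf : Measurable f) (m : ℝ) (k : ℕ) :
    ∫⁻ x, ‖U₁ f (k + 1) x‖ₑ ^ m ∂a.splitLaw lam = ∫⁻ x, ‖U₁ f 0 x‖ₑ ^ m ∂a.splitLaw a.ν := by
  have step (lam : Measure S) [IsProbabilityMeasure lam] (k : ℕ) :
      ∫⁻ x, ‖U₁ f (k + 1) x‖ₑ ^ m ∂a.splitLaw lam =
        ∫⁻ x, ‖U₁ f k x‖ₑ ^ m ∂a.splitLaw a.ν := by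
    have hm : Measurable fun x : ℕ → S × Bool => ‖U₁ f k x‖ₑ ^ m :=
      (measurable_U₁ hf k).enorm.pow_const m
    have : ∀ᵐ x ∂a.splitLaw lam, ‖U₁ f (k + 1) x‖ₑ ^ m =
        ∑' u : ℕ, if hit x = u then ‖U₁ f k (shift (u + 1) x)‖ₑ ^ m else 0 := by
      filter_upwards [a.ae_hit_ne_top hP lam] with x hx
      obtain ⟨u, hu⟩ := ENat.ne_top_iff_exists.1 hx
      rw [tsum_eq_single u fun v hv => if_neg (by rw [← hu, Nat.cast_inj]; exact hv.symm),
        if_pos hu.symm, U₁_succ_of_eq f hu.symm]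
    rw [lintegral_congr_ae this, lintegral_tsum fun u => (measurable_ite_hit hm u).aemeasurable]
    simp_rw [fun u => a.lintegral_hit_eq lam u hm]
    rw [ENNReal.tsum_mul_right, a.tsum_measure_hit_eq hP, one_mul]
  rw [step]
  induction k with
  | zero => rfl
  | succ k ih => rw [step, ih]

variable {E₁ E₂ : Type*} [MeasurableSpace E₁] [MeasurableSpace E₂]
  {P₁ : Kernel E₁ E₁} [IsMarkovKernel P₁] {φ₁ : Measure E₁}
  {P₂ : Kernel E₂ E₂} [IsMarkovKernel P₂] {φ₂ : Measure E₂}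
  (a₁ : Atom P₁ φ₁) (a₂ : Atom P₂ φ₂)

instance (lam₁ : Measure E₁) (lam₂ : Measure E₂) [IsProbabilityMeasure lam₁]
    [IsProbabilityMeasure lam₂] : IsProbabilityMeasure (jointLaw a₁ a₂ lam₁ lam₂) := by
  unfold jointLaw; infer_instance

lemma measurableSet_hitPair_eq (c : ℕ∞) :
    MeasurableSet {ω : (ℕ → E₁ × Bool) × (ℕ → E₂ × Bool) | hitPair ω = c} :=
  measurable_hitPair (MeasurableSet.singleton c)

lemma measurable_ite_hitPair {F : (ℕ → E₁ × Bool) × (ℕ → E₂ × Bool) → ℝ≥0∞} (hF : Measurable F)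
    (u : ℕ) : Measurable fun ω => if hitPair ω = u then F (shiftPair (u + 1) ω) else 0 :=
  Measurable.ite (measurableSet_hitPair_eq _) (by fun_prop) measurable_const

/-- The compound chain starts afresh after its first regeneration. -/
lemma lintegral_hitPair_eq (lam₁ : Measure E₁) (lam₂ : Measure E₂) [IsProbabilityMeasure lam₁]
    [IsProbabilityMeasure lam₂] (u : ℕ) {F : (ℕ → E₁ × Bool) × (ℕ → E₂ × Bool) → ℝ≥0∞}
    (hF : Measurable F) :
    ∫⁻ ω, (if hitPair ω = u then F (shiftPair (u + 1) ω) else 0) ∂jointLaw a₁ a₂ lam₁ lam₂ =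
      jointLaw a₁ a₂ lam₁ lam₂ {ω | hitPair ω = u} * ∫⁻ ω, F ω ∂jointLaw a₁ a₂ a₁.ν a₂.ν := by
  have hS := measurableSet_hitPair_eq (E₁ := E₁) (E₂ := E₂) u
  set e : (ℕ → E₁ × Bool) × (ℕ → E₂ × Bool) → ℝ≥0∞ := {ω | hitPair ω = u}.indicator 1 with he_def
  have he : Measurable e := measurable_one.indicator hS
  have hm₂ : MeasurableSet {p : (ℕ → E₁ × Bool) × (ℕ → E₂ × Bool) | (p.2 u).2 = true} :=
    measurableSet_eq_fun (by fun_prop) measurable_const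
  -- Regeneration is applied to the second chain with the first path held fixed, then to the first
  -- chain with `A` as its past.
  set A : (ℕ → E₁ × Bool) → ℝ≥0∞ := fun x =>
    ∫⁻ w, (if (w u).2 = true then e (x, stopAt u w) else 0) ∂a₂.splitLaw lam₂ with hA_def
  have hA : Measurable A :=
    Measurable.lintegral_prod_right' (f := fun p : (ℕ → E₁ × Bool) × (ℕ → E₂ × Bool) =>
      if (p.2 u).2 = true then e (p.1, stopAt u p.2) else 0)
      (Measurable.ite hm₂ (by fun_prop) measurable_const)
  have key {F : (ℕ → E₁ × Bool) × (ℕ → E₂ × Bool) → ℝ≥0∞} (hF : Measurable F) :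
      ∫⁻ ω, (if hitPair ω = u then F (shiftPair (u + 1) ω) else 0) ∂jointLaw a₁ a₂ lam₁ lam₂ =
        (∫⁻ x, (if (x u).2 = true then A (stopAt u x) else 0) ∂a₁.splitLaw lam₁) *
          ∫⁻ ω, F ω ∂jointLaw a₁ a₂ a₁.ν a₂.ν := by
    have hm := measurable_ite_hitPair hF u
    have hB : Measurable fun x => ∫⁻ w, F (x, w) ∂a₂.splitLaw a₂.ν := hF.lintegral_prod_right'
    rw [jointLaw, jointLaw, lintegral_prod _ hm.aemeasurable, lintegral_prod _ hF.aemeasurable,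
      ← a₁.lintegral_of_mark_true u lam₁ hA hB]
    refine lintegral_congr fun x => ?_
    by_cases hx : (x u).2 = true
    · rw [if_pos hx, hA_def]
      simp only
      rw [← a₂.lintegral_of_mark_true u lam₂ (A := fun w => e (stopAt u x, w))
        (B := fun w => F (shift (u + 1) x, w)) (by fun_prop) (by fun_prop)]
      refine lintegral_congr fun w => ?_
      by_cases hw : (w u).2 = true <;> by_cases hs : hitPair (stopAt u x, stopAt u w) = u <;>
        simp [he_def, hitPair_eq_iff_stopAt (x, w) u, hx, hw, hs, shiftPair]
    · rw [if_neg hx]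
      simp [hitPair_eq_iff_stopAt (x, _) u, hx]
  rw [key hF, ← lintegral_indicator_one hS]
  congr 1
  -- The case `F = 1` identifies the constant in `key` as the probability of the event.
  have h1 := key (F := fun _ => 1) measurable_const
  simp only [lintegral_const, measure_univ, mul_one] at h1
  rw [← h1]
  exact lintegral_congr fun ω => by simp [Set.indicator_apply]

/-- The moments of the blocks `U_k`, `k ≥ 1`, of the compound chain are at most those of its first
block under the regeneration measure. -/
lemma lintegral_U_succ_le {g : E₁ → E₂ → ℝ} (hg : Measurable fun p : E₁ × E₂ => g p.1 p.2)
    {p : ℝ} (hp : 0 < p) (lam₁ : Measure E₁) (lam₂ : Measure E₂) [IsProbabilityMeasure lam₁]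
    [IsProbabilityMeasure lam₂] (k : ℕ) :
    ∫⁻ ω, ‖U g (k + 1) ω‖ₑ ^ p ∂jointLaw a₁ a₂ lam₁ lam₂ ≤
      ∫⁻ ω, ‖U g 0 ω‖ₑ ^ p ∂jointLaw a₁ a₂ a₁.ν a₂.ν := by
  have step (lam₁ : Measure E₁) (lam₂ : Measure E₂) [IsProbabilityMeasure lam₁]
      [IsProbabilityMeasure lam₂] (k : ℕ) :
      ∫⁻ ω, ‖U g (k + 1) ω‖ₑ ^ p ∂jointLaw a₁ a₂ lam₁ lam₂ ≤
        ∫⁻ ω, ‖U g k ω‖ₑ ^ p ∂jointLaw a₁ a₂ a₁.ν a₂.ν := by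
    have hm : Measurable fun ω : (ℕ → E₁ × Bool) × (ℕ → E₂ × Bool) => ‖U g k ω‖ₑ ^ p :=
      (measurable_U hg k).enorm.pow_const p
    have hpt (ω : (ℕ → E₁ × Bool) × (ℕ → E₂ × Bool)) : ‖U g (k + 1) ω‖ₑ ^ p =
        ∑' u : ℕ, if hitPair ω = u then ‖U g k (shiftPair (u + 1) ω)‖ₑ ^ p else 0 := by
      rcases eq_or_ne (hitPair ω) ⊤ with h | h
      · simp [U_succ_of_top g h, h, hp]
      · obtain ⟨u, hu⟩ := ENat.ne_top_iff_exists.1 h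
        rw [tsum_eq_single u fun v hv => if_neg (by rw [← hu, Nat.cast_inj]; exact hv.symm),
          if_pos hu.symm, U_succ_of_eq g hu.symm]
    simp_rw [hpt]
    rw [lintegral_tsum fun u => (measurable_ite_hitPair hm u).aemeasurable]
    simp_rw [fun u => lintegral_hitPair_eq a₁ a₂ lam₁ lam₂ u hm]
    rw [ENNReal.tsum_mul_right]
    -- Only total mass at most `1` is needed, since the later blocks are empty when the compound
    -- chain never regenerates.
    exact mul_le_of_le_one_left zero_le (tsum_measure_eq_coe_le_one _ measurable_hitPair)
  refine (step lam₁ lam₂ k).trans ?_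
  induction k with
  | zero => rfl
  | succ k ih => exact (step _ _ k).trans ih

end Regeneration

end SplitChain

namespace SplitChain

/-! ### Subinvariance of `π_s` and iteration of the renewal inequality -/

section Potential

variable {S : Type*} [MeasurableSpace S]

/-- If `ν + π K ≤ π` then `∫ f dν ≤ ∫ v dπ` for every iterate `f` of `f ↦ v + K f` from `0`. -/
lemma lintegral_iterate_le {K : Kernel S S} {v : S → ℝ≥0∞} (hv : Measurable v)
    {f : ℕ → S → ℝ≥0∞} (hf : ∀ N, Measurable (f N)) (h0 : ∀ w, f 0 w = 0)
    (hstep : ∀ N w, f (N + 1) w ≤ v w + ∫⁻ y, f N y ∂K w) (N : ℕ) {ν π : Measure S}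
    (h : ν + π.bind K ≤ π) : ∫⁻ w, f N w ∂ν ≤ ∫⁻ w, v w ∂π := by
  -- The hypothesis is preserved when `(ν, π)` is replaced by `(ν K, π K)`, the pair to which the
  -- induction hypothesis is applied.
  induction N generalizing ν π with
  | zero => simp [h0]
  | succ N ih =>
    have hmono {μ ρ : Measure S} (hle : μ ≤ ρ) : μ.bind K ≤ ρ.bind K :=
      Measure.le_iff.2 fun A hA => by
        rw [Measure.bind_apply hA K.aemeasurable, Measure.bind_apply hA K.aemeasurable]
        exact lintegral_mono' hle le_rfl
    have hadd (μ ρ : Measure S) : (μ + ρ).bind K = μ.bind K + ρ.bind K :=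
      Measure.ext fun A hA => by
        rw [Measure.add_apply, Measure.bind_apply hA K.aemeasurable,
          Measure.bind_apply hA K.aemeasurable, Measure.bind_apply hA K.aemeasurable,
          lintegral_add_measure]
    have h' : ν.bind K + (π.bind K).bind K ≤ π.bind K := by
      rw [← hadd]
      exact hmono h
    calc ∫⁻ w, f (N + 1) w ∂ν ≤ ∫⁻ w, (v w + ∫⁻ y, f N y ∂K w) ∂ν :=
          lintegral_mono fun w => hstep N w
      _ = ∫⁻ w, v w ∂ν + ∫⁻ w, f N w ∂(ν.bind K) := by
        rw [lintegral_add_left hv, Measure.lintegral_bind K.aemeasurable (hf N).aemeasurable]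
      _ ≤ ∫⁻ w, v w ∂ν + ∫⁻ w, v w ∂(π.bind K) := add_le_add le_rfl (ih h')
      _ = ∫⁻ w, v w ∂(ν + π.bind K) := (lintegral_add_measure _ _ _).symm
      _ ≤ ∫⁻ w, v w ∂π := lintegral_mono' h le_rfl

variable {P : Kernel S S} [IsMarkovKernel P] {φ : Measure S} (a : Atom P φ)

namespace Atom

lemma lintegral_piS {F : S → ℝ≥0∞} (hF : Measurable F) :
    ∫⁻ y, F y ∂a.piS = ∑' l : ℕ, ∫⁻ x, ∫⁻ y, F y ∂(a.H ^ l) x ∂a.ν := by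
  rw [piS, Measure.lintegral_bind a.G.aemeasurable hF.aemeasurable,
    ← lintegral_tsum fun l => hF.lintegral_kernel.aemeasurable]
  refine lintegral_congr fun x => ?_
  rw [G, Kernel.sum_apply, lintegral_sum_measure]

/-- Splitting off the term `l = 0` of `∑ ν H^l` gives `π_s = ν + π_s H`. -/
lemma lintegral_piS_eq {F : S → ℝ≥0∞} (hF : Measurable F) :
    ∫⁻ y, F y ∂a.piS = ∫⁻ y, F y ∂a.ν + ∫⁻ z, ∫⁻ y, F y ∂a.H z ∂a.piS := by
  have hHF : Measurable fun z => ∫⁻ y, F y ∂a.H z := hF.lintegral_kernel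
  rw [a.lintegral_piS hF, a.lintegral_piS hHF, tsum_eq_zero_add' ENNReal.summable]
  congr 1
  · exact lintegral_congr fun x => lintegral_dirac' x hF
  · refine tsum_congr fun l => lintegral_congr fun x => ?_
    rw [pow_succ']
    exact Kernel.lintegral_comp _ _ _ hF

/-- Since `s = 1 - H 1`, the sum telescopes: `∑_{l<n} H^l s + H^n 1 = 1`. -/
lemma lintegral_s_piS_le_one : ∫⁻ y, a.s y ∂a.piS ≤ 1 := by
  have hsum (n : ℕ) (x : S) :
      ∑ l ∈ Finset.range n, ∫⁻ y, a.s y ∂(a.H ^ l) x + (a.H ^ n) x Set.univ = 1 := by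
    induction n with
    | zero =>
      rw [Finset.range_zero, Finset.sum_empty, zero_add, pow_zero]
      exact measure_univ (μ := Measure.dirac x)
    | succ n ih =>
      have h1 : (a.H ^ (n + 1)) x Set.univ = ∫⁻ y, (1 - a.s y) ∂(a.H ^ n) x := by
        rw [Kernel.pow_succ_apply_eq_lintegral _ _ _ MeasurableSet.univ]
        simp_rw [H_univ]
      rw [Finset.sum_range_succ, add_assoc, h1, ← lintegral_add_left a.measurable_s]
      simp_rw [add_tsub_cancel_of_le (a.s_le_one _)]
      rwa [lintegral_one]
  rw [a.lintegral_piS a.measurable_s, ENNReal.tsum_eq_iSup_nat]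
  refine iSup_le fun n => ?_
  rw [← lintegral_finsetSum _ fun l _ => a.measurable_s.lintegral_kernel]
  calc ∫⁻ x, ∑ l ∈ Finset.range n, ∫⁻ y, a.s y ∂(a.H ^ l) x ∂a.ν ≤ ∫⁻ _, 1 ∂a.ν :=
        lintegral_mono fun x => (hsum n x).le.trans' le_self_add
    _ = 1 := by simp

/-- The measure `π_s` is subinvariant. -/
lemma lintegral_P_piS_le {F : S → ℝ≥0∞} (hF : Measurable F) :
    ∫⁻ z, ∫⁻ y, F y ∂P z ∂a.piS ≤ ∫⁻ y, F y ∂a.piS := by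
  -- `π_s P = π_s(s) ν + π_s H ≤ ν + π_s H = π_s`.
  simp_rw [a.lintegral_P]
  rw [lintegral_add_left (a.measurable_s.mul_const _), lintegral_mul_const _ a.measurable_s,
    a.lintegral_piS_eq hF]
  gcongr
  exact mul_le_of_le_one_left zero_le a.lintegral_s_piS_le_one

lemma lintegral_pow_piS_le {F : S → ℝ≥0∞} (hF : Measurable F) (t : ℕ) :
    ∫⁻ z, ∫⁻ y, F y ∂(P ^ t) z ∂a.piS ≤ ∫⁻ y, F y ∂a.piS := by
  induction t with
  | zero => exact (lintegral_congr fun x => lintegral_dirac' x hF).le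
  | succ t ih =>
    have hG : Measurable fun z => ∫⁻ y, F y ∂(P ^ t) z := hF.lintegral_kernel
    refine le_trans (le_of_eq (lintegral_congr fun z => ?_)) ((a.lintegral_P_piS_le hG).trans ih)
    rw [pow_succ]
    exact Kernel.lintegral_comp _ _ _ hF

/-- The transition kernel of the chain observed at independent times with law `b`
and killed when its mark at such a time is `1`. -/
def sampledH (b : ℕ → ℝ≥0∞) : Kernel S S where
  toFun w := Measure.sum fun u => b u • (a.H ∘ₖ (P ^ u)) w
  measurable' := by
    refine Measure.measurable_of_measurable_coe _ fun A hA => ?_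
    simp only [Measure.sum_apply _ hA, Measure.smul_apply, smul_eq_mul]
    exact Measurable.tsum fun u => (Kernel.measurable_coe _ hA).const_mul _

lemma lintegral_sampledH (b : ℕ → ℝ≥0∞) (w : S) (F : S → ℝ≥0∞) :
    ∫⁻ y, F y ∂a.sampledH b w = ∑' u, b u * ∫⁻ y, F y ∂(a.H ∘ₖ (P ^ u)) w := by
  change ∫⁻ y, F y ∂(Measure.sum fun u => b u • (a.H ∘ₖ (P ^ u)) w) = _
  rw [lintegral_sum_measure]
  simp_rw [lintegral_smul_measure, smul_eq_mul]

/-- Subinvariance under each `P ^ u`, averaged over the sub-probability `b`, shows that sampling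
first does not increase `π_s H`; then `ν + π_s H = π_s`. -/
lemma add_bind_sampledH_le {b : ℕ → ℝ≥0∞} (hb : ∑' u, b u ≤ 1) :
    a.ν + a.piS.bind (a.sampledH b) ≤ a.piS := by
  refine Measure.le_iff.2 fun A hA => ?_
  have hF : Measurable (A.indicator (1 : S → ℝ≥0∞)) := measurable_one.indicator hA
  have hG : Measurable fun z => ∫⁻ y, A.indicator (1 : S → ℝ≥0∞) y ∂a.H z := hF.lintegral_kernel
  have hbind : ∫⁻ y, A.indicator 1 y ∂a.piS.bind (a.sampledH b) ≤
      ∫⁻ z, ∫⁻ y, A.indicator (1 : S → ℝ≥0∞) y ∂a.H z ∂a.piS := by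
    rw [Measure.lintegral_bind (Kernel.aemeasurable _) hF.aemeasurable]
    simp_rw [lintegral_sampledH]
    rw [lintegral_tsum fun u => (hF.lintegral_kernel.const_mul _).aemeasurable]
    calc ∑' u, ∫⁻ w, b u * ∫⁻ y, A.indicator 1 y ∂(a.H ∘ₖ (P ^ u)) w ∂a.piS
        ≤ ∑' u, b u * ∫⁻ z, ∫⁻ y, A.indicator (1 : S → ℝ≥0∞) y ∂a.H z ∂a.piS := by
          refine ENNReal.tsum_le_tsum fun u => ?_
          rw [lintegral_const_mul _ hF.lintegral_kernel]
          simp_rw [fun w => Kernel.lintegral_comp a.H (P ^ u) w hF]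
          exact mul_le_mul' le_rfl (a.lintegral_pow_piS_le hG u)
      _ ≤ _ := by
        rw [ENNReal.tsum_mul_right]
        exact mul_le_of_le_one_left zero_le hb
  rw [Measure.add_apply, ← lintegral_indicator_one hA, ← lintegral_indicator_one hA,
    ← lintegral_indicator_one hA, a.lintegral_piS_eq hF]
  gcongr

end Atom

end Potential

/-! ### The two moment bounds -/

section SubBlocks

variable {E₁ E₂ : Type*} [MeasurableSpace E₁] [MeasurableSpace E₂]
  {P₁ : Kernel E₁ E₁} [IsMarkovKernel P₁] {φ₁ : Measure E₁}
  {P₂ : Kernel E₂ E₂} [IsMarkovKernel P₂] {φ₂ : Measure E₂}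
  (a₁ : Atom P₁ φ₁) (a₂ : Atom P₂ φ₂) {gX : E₁ → ℝ} {gW : E₂ → ℝ}

/-- The expected first sub-block, as a function of the initial state of the second chain. -/
lemma lintegral_V_zero_le (hgX : Measurable gX) (hgW : Measurable gW) {m : ℝ} (hm : 1 ≤ m)
    (w : E₂) :
    ∫⁻ y, ∫⁻ x, ‖V (fun x w => gX x * gW w) 0 (x, y)‖ₑ ^ m ∂a₁.splitLaw a₁.ν ∂a₂.splitK w ≤
      ∑' t : ℕ, (∫⁻ x, blockTerm gX t x * blockMass gX x ^ (m - 1) ∂a₁.splitLaw a₁.ν) *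
        ∫⁻ z, ‖gW z‖ₑ ^ m ∂(P₂ ^ t) w := by
  have hc (t : ℕ) : Measurable fun x => blockTerm gX t x * blockMass gX x ^ (m - 1) :=
    (measurable_blockTerm hgX t).mul ((measurable_blockMass hgX).pow_const _)
  have hf : Measurable fun z => ‖gW z‖ₑ ^ m := hgW.enorm.pow_const m
  calc ∫⁻ y, ∫⁻ x, ‖V (fun x w => gX x * gW w) 0 (x, y)‖ₑ ^ m ∂a₁.splitLaw a₁.ν ∂a₂.splitK w
      ≤ ∫⁻ y, ∫⁻ x, ∑' t : ℕ, blockTerm gX t x * blockMass gX x ^ (m - 1) * ‖gW (y t).1‖ₑ ^ m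
          ∂a₁.splitLaw a₁.ν ∂a₂.splitK w :=
        lintegral_mono fun y => lintegral_mono fun x => enorm_V_zero_rpow_le gX gW hm (x, y)
    _ = ∫⁻ y, ∑' t : ℕ, (∫⁻ x, blockTerm gX t x * blockMass gX x ^ (m - 1) ∂a₁.splitLaw a₁.ν) *
          ‖gW (y t).1‖ₑ ^ m ∂a₂.splitK w := by
        refine lintegral_congr fun y => ?_
        rw [lintegral_tsum fun t => ((hc t).mul_const _).aemeasurable]
        exact tsum_congr fun t => lintegral_mul_const _ (hc t)
    _ = _ := by
        rw [lintegral_tsum fun t => (Measurable.const_mul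
          (f := fun y : ℕ → E₂ × Bool => ‖gW (y t).1‖ₑ ^ m) (by fun_prop) _).aemeasurable]
        refine tsum_congr fun t => ?_
        rw [lintegral_const_mul _ (by fun_prop), a₂.lintegral_state t w hf]

/-- The expectation of a functional of the pair of split chains after the first regeneration of the
first one, on the event that the mark of the second one is then `0`. -/
lemma lintegral_after_hit {F : (ℕ → E₁ × Bool) × (ℕ → E₂ × Bool) → ℝ≥0∞} (hF : Measurable F)
    (w : E₂) :
    ∫⁻ y, ∫⁻ x, (∑' u : ℕ, if hit x = u then
        (if (y u).2 = false then F (shiftPair (u + 1) (x, y)) else 0) else 0)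
        ∂a₁.splitLaw a₁.ν ∂a₂.splitK w =
      ∫⁻ z, ∫⁻ y, ∫⁻ x, F (x, y) ∂a₁.splitLaw a₁.ν ∂a₂.splitK z
        ∂a₂.sampledH (fun u => a₁.splitLaw a₁.ν {x | hit x = u}) w := by
  have hG : Measurable fun y => ∫⁻ x, F (x, y) ∂a₁.splitLaw a₁.ν := hF.lintegral_prod_left'
  have hinner (y : ℕ → E₂ × Bool) : ∫⁻ x, (∑' u : ℕ, if hit x = u then
        (if (y u).2 = false then F (shiftPair (u + 1) (x, y)) else 0) else 0) ∂a₁.splitLaw a₁.ν =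
      ∑' u : ℕ, a₁.splitLaw a₁.ν {x | hit x = u} * (if (y u).2 = false then
        ∫⁻ x, F (x, shift (u + 1) y) ∂a₁.splitLaw a₁.ν else 0) := by
    have hFy (u : ℕ) : Measurable fun x =>
        if (y u).2 = false then F (x, shift (u + 1) y) else 0 := by
      split_ifs <;> fun_prop
    refine (lintegral_tsum fun u => (measurable_ite_hit (hFy u) u).aemeasurable).trans ?_
    refine tsum_congr fun u => (a₁.lintegral_hit_eq a₁.ν u (hFy u)).trans ?_
    split_ifs <;> simp
  have hGu (u : ℕ) : Measurable fun y : ℕ → E₂ × Bool => if (y u).2 = false then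
      ∫⁻ x, F (x, shift (u + 1) y) ∂a₁.splitLaw a₁.ν else 0 :=
    Measurable.ite (measurableSet_eq_fun (by fun_prop) measurable_const)
      (hG.comp (measurable_shift (u + 1))) measurable_const
  simp_rw [hinner]
  rw [lintegral_tsum fun u => ((hGu u).const_mul _).aemeasurable, Atom.lintegral_sampledH]
  refine tsum_congr fun u => ?_
  rw [lintegral_const_mul _ (hGu u), a₂.lintegral_shift_of_mark_false u w hG,
    a₂.lintegral_splitLaw _ hG]

/-- The moment bound for the sub-blocks of the compound chain. -/
theorem lintegral_sumV_le (hX : IsHarrisRecurrent P₁ φ₁) (hgX : Measurable gX)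
    (hgW : Measurable gW) {m : ℝ} (hm : 1 ≤ m) (lam₁ : Measure E₁) [IsProbabilityMeasure lam₁]
    (k : ℕ) :
    ∫⁻ ω, sumV (fun x w => gX x * gW w) m ω ∂jointLaw a₁ a₂ a₁.ν a₂.ν ≤
      (∫⁻ w, ‖gW w‖ₑ ^ m ∂a₂.piS) *
        ∫⁻ x, ‖U₁ (fun z => |gX z|) (k + 1) x‖ₑ ^ m ∂a₁.splitLaw lam₁ := by
  have hm0 : 0 < m := by linarith
  have hg : Measurable fun p : E₁ × E₂ => gX p.1 * gW p.2 := by fun_prop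
  have hf : Measurable fun z => ‖gW z‖ₑ ^ m := hgW.enorm.pow_const m
  have hS := measurable_sumVPartial (g := fun x w => gX x * gW w) hg m
  set c : ℕ → ℝ≥0∞ := fun t =>
    ∫⁻ x, blockTerm gX t x * blockMass gX x ^ (m - 1) ∂a₁.splitLaw a₁.ν
  -- Summing the weights over `t` gives `blockMass ^ m`, and almost sure regeneration identifies
  -- `blockMass` with the real block sum.
  have hc : ∑' t, c t = ∫⁻ x, ‖U₁ (fun z => |gX z|) (k + 1) x‖ₑ ^ m ∂a₁.splitLaw lam₁ := by
    rw [a₁.lintegral_U₁_succ hX lam₁ hgX.abs, ← lintegral_tsum fun t =>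
      ((measurable_blockTerm hgX t).fun_mul ((measurable_blockMass hgX).pow_const _)).aemeasurable]
    refine lintegral_congr_ae ?_
    filter_upwards [a₁.ae_hit_ne_top hX a₁.ν] with x hx
    rw [enorm_U₁_zero gX hx, ENNReal.tsum_mul_right]
    change blockMass gX x * blockMass gX x ^ (m - 1) = _
    nth_rw 1 [← ENNReal.rpow_one (blockMass gX x)]
    rw [← ENNReal.rpow_add_of_nonneg 1 (m - 1) zero_le_one (by linarith), add_sub_cancel]
  set v : E₂ → ℝ≥0∞ := fun w => ∑' t, c t * ∫⁻ z, ‖gW z‖ₑ ^ m ∂(P₂ ^ t) w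
  have hv : Measurable v := Measurable.tsum fun t => hf.lintegral_kernel.const_mul _
  have hvpi : ∫⁻ w, v w ∂a₂.piS ≤ (∫⁻ w, ‖gW w‖ₑ ^ m ∂a₂.piS) * ∑' t, c t := by
    rw [lintegral_tsum fun t => (hf.lintegral_kernel.const_mul _).aemeasurable,
      ← ENNReal.tsum_mul_left]
    refine ENNReal.tsum_le_tsum fun t => ?_
    rw [lintegral_const_mul _ hf.lintegral_kernel, mul_comm]
    exact mul_le_mul' (a₂.lintegral_pow_piS_le hf t) le_rfl
  let f : ℕ → E₂ → ℝ≥0∞ := fun N w => ∫⁻ y, ∫⁻ x, sumVPartial (fun x w => gX x * gW w) m N (x, y)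
    ∂a₁.splitLaw a₁.ν ∂a₂.splitK w
  have hfm (N : ℕ) : Measurable (f N) := (hS N).lintegral_prod_left'.lintegral_kernel
  have hstep (N : ℕ) (w : E₂) : f (N + 1) w ≤ v w + ∫⁻ z, f N z
      ∂a₂.sampledH (fun u => a₁.splitLaw a₁.ν {x | hit x = u}) w := by
    have hV : Measurable fun ω => ‖V (fun x w => gX x * gW w) 0 ω‖ₑ ^ m :=
      (measurable_V (g := fun x w => gX x * gW w) hg 0).enorm.pow_const m
    rw [← lintegral_after_hit a₁ a₂ (hS N) w]
    refine le_trans (le_of_eq ?_) (add_le_add_left (lintegral_V_zero_le a₁ a₂ hgX hgW hm w) _)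
    rw [← lintegral_add_left hV.lintegral_prod_left']
    refine lintegral_congr fun y => ?_
    have hVy : Measurable fun x => ‖V (fun x w => gX x * gW w) 0 (x, y)‖ₑ ^ m :=
      hV.comp (measurable_id.prodMk measurable_const)
    rw [← lintegral_add_left hVy]
    exact lintegral_congr fun x => sumVPartial_succ (ω := (x, y)) _ hm0 N
  rw [← hc]
  refine le_trans ?_ hvpi
  simp_rw [sumV_eq_iSup]
  -- Truncation lets the recursion start from `f 0 = 0`; monotone convergence removes it.
  rw [lintegral_iSup hS fun N M h ω => Finset.sum_le_sum_of_subset (Finset.range_mono h)]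
  refine iSup_le fun N => ?_
  rw [jointLaw, lintegral_prod_symm _ (hS N).aemeasurable,
    a₂.lintegral_splitLaw _ (hS N).lintegral_prod_left']
  exact lintegral_iterate_le hv hfm (fun w => by simp [f, sumVPartial]) hstep N
    (a₂.add_bind_sampledH_le (tsum_measure_eq_coe_le_one _ measurable_hit))

/-- The moment bound for the blocks of the compound chain. -/
theorem lintegral_U_le {g : E₁ → E₂ → ℝ} (hg : Measurable fun p : E₁ × E₂ => g p.1 p.2) {p δ : ℝ}
    (hp : 0 < p) (hδ : 0 < δ) (lam₁ : Measure E₁) (lam₂ : Measure E₂) [IsProbabilityMeasure lam₁]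
    [IsProbabilityMeasure lam₂] (k : ℕ) :
    ∫⁻ ω, ‖U g (k + 1) ω‖ₑ ^ p ∂jointLaw a₁ a₂ lam₁ lam₂ ≤
      (∫⁻ ω, sumV g (p * (1 + δ)) ω ∂jointLaw a₁ a₂ a₁.ν a₂.ν) ^ (1 / (1 + δ)) *
        (∫⁻ ω, ((T ω : ℝ≥0∞) + 1) ^ (p * (1 + δ⁻¹)) ∂jointLaw a₁ a₂ a₁.ν a₂.ν) ^ (δ / (1 + δ)) := by
  have hδ1 : 0 < 1 + δ := by linarith
  -- The exponent `1 + δ` cancels the power `p / (p * (1 + δ))` of `sumV`, and its conjugate turns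
  -- `p` into `p * (1 + δ⁻¹)`.
  have hconj : (1 + δ).HolderConjugate ((1 + δ) / δ) := by
    refine Real.holderConjugate_iff.2 ⟨by linarith, ?_⟩
    field_simp
  have hT : Measurable fun ω : (ℕ → E₁ × Bool) × (ℕ → E₂ × Bool) => (T ω : ℝ≥0∞) :=
    (measurable_of_countable fun n : ℕ∞ => (n : ℝ≥0∞)).comp measurable_T
  refine (lintegral_U_succ_le a₁ a₂ hg hp lam₁ lam₂ k).trans ?_
  refine (lintegral_mono fun ω => enorm_U_zero_rpow_le g hp (mul_pos hp hδ1) ω).trans ?_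
  refine (ENNReal.lintegral_mul_le_Lp_mul_Lq _ hconj
    ((measurable_sumV hg _).pow_const _).aemeasurable
    ((hT.add_const 1).pow_const p).aemeasurable).trans (le_of_eq ?_)
  simp only [← ENNReal.rpow_mul]
  have e1 : p / (p * (1 + δ)) * (1 + δ) = 1 := by field_simp
  have e2 : p * ((1 + δ) / δ) = p * (1 + δ⁻¹) := by field_simp; ring
  have e3 : 1 / ((1 + δ) / δ) = δ / (1 + δ) := by field_simp
  simp only [e1, e2, e3, ENNReal.rpow_one]

end SubBlocks

end SplitChain

end

theorem theorem3p2 {E₁ E₂ : Type*} [MeasurableSpace E₁] [MeasurableSpace E₂]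
    (P₁ : Kernel E₁ E₁) [IsMarkovKernel P₁] (φ₁ : Measure E₁)
    (P₂ : Kernel E₂ E₂) [IsMarkovKernel P₂] (φ₂ : Measure E₂)
    (hX : SplitChain.IsHarrisRecurrent P₁ φ₁) (hW : SplitChain.IsErgodic P₂ φ₂)
    (a₁ : SplitChain.Atom P₁ φ₁) (a₂ : SplitChain.Atom P₂ φ₂)
    (gX : E₁ → ℝ) (hgX : Measurable gX) (gW : E₂ → ℝ) (hgW : Measurable gW) :
    (∀ m : ℝ, 1 ≤ m → ∀ lam₁ : Measure E₁, IsProbabilityMeasure lam₁ → ∀ k : ℕ, 1 ≤ k →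
      ∫⁻ ω, SplitChain.sumV (fun x w => gX x * gW w) m ω
          ∂(SplitChain.jointLaw a₁ a₂ a₁.ν a₂.ν) ≤
        (∫⁻ w, ‖gW w‖ₑ ^ m ∂a₂.piS) *
          ∫⁻ x, ‖SplitChain.U₁ (fun z => |gX z|) k x‖ₑ ^ m ∂(a₁.splitLaw lam₁)) ∧
    (∀ p : ℝ, 0 < p → ∀ δ : ℝ, 0 < δ →
      ∀ lam₁ : Measure E₁, IsProbabilityMeasure lam₁ →
      ∀ lam₂ : Measure E₂, IsProbabilityMeasure lam₂ → ∀ k : ℕ, 1 ≤ k →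
      ∫⁻ ω, ‖SplitChain.U (fun x w => gX x * gW w) k ω‖ₑ ^ p
          ∂(SplitChain.jointLaw a₁ a₂ lam₁ lam₂) ≤
        (∫⁻ ω, SplitChain.sumV (fun x w => gX x * gW w) (p * (1 + δ)) ω
            ∂(SplitChain.jointLaw a₁ a₂ a₁.ν a₂.ν)) ^ (1 / (1 + δ)) *
          (∫⁻ ω, ((SplitChain.T ω : ℝ≥0∞) + 1) ^ (p * (1 + δ⁻¹))
            ∂(SplitChain.jointLaw a₁ a₂ a₁.ν a₂.ν)) ^ (δ / (1 + δ))) := by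
  refine ⟨fun m hm lam₁ _ k hk => ?_, fun p hp δ hδ lam₁ _ lam₂ _ k hk => ?_⟩
  · obtain ⟨k, rfl⟩ := Nat.exists_eq_succ_of_ne_zero (Nat.one_le_iff_ne_zero.1 hk)
    exact SplitChain.lintegral_sumV_le a₁ a₂ hX hgX hgW hm lam₁ k
  · obtain ⟨k, rfl⟩ := Nat.exists_eq_succ_of_ne_zero (Nat.one_le_iff_ne_zero.1 hk)
    exact SplitChain.lintegral_U_le a₁ a₂ (g := fun x w => gX x * gW w) (by fun_prop) hp hδ
      lam₁ lam₂ k
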